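/- Let $\mathbb S=\mathbb R/\mathbb Z$, identified with $[0,1)$, let $b\ge 0$ and $c>0$ be real numbers, let $p\ge 1$ be an integer, and consider for real-valued functions the equation $$u_t-u_{txx}+(b+c)u^pu_x=b\,u^{p-1}u_xu_{xx}+c\,u^pu_{xxx},\qquad x\in\mathbb S. \tag{1}$$ Let $T>0$, $s>3/2$, and let $u\in C^0([0,T),H^s(\mathbb S))$ be a solution of (1) on $(0,T)\times\mathbb S$ in the sense of distributions, where $u^{p-1}u_xu_{xx}$ and $u^pu_{xxx}$ are understood as $\tfrac12\partial_x(u^{p-1}u_x^2)-\tfrac{p-1}2u^{p-2}u_x^3$ and $\partial_x^2(u^pu_x)-\tfrac{3p}2\partial_x(u^{p-1}u_x^2)+\tfrac{p(p-1)}2u^{p-2}u_x^3$, the terms with the factor $p-1$ being absent when $p=1$. Write $u_0=u(0,\cdot)$ and $m_0=u_0-u_0''$. Suppose that one of the following holds: - $p=1$ and $b\in[0,3c]$; or - $b=pc$ and $p$ is odd; or - $b=pc$, $p$ is even, $s=3$, and either $m_0\ge 0$ on $\mathbb S$ or $m_0\le 0$ on $\mathbb S$. If there exist $t^\ast\in(0,T)$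 and $x_0,x_1\in[0,1)$ with $x_0<x_1$ such that $u(t^\ast,x)=0$ for all $x\in[x_0,x_1]$ and $u_t(t^\ast,x_0)=u_t(t^\ast,x_1)=0$, then $u(t,x)=0$ for all $(t,x)\in[0,T)\times\mathbb S$. -/

import Mathlib

open MeasureTheory Set Filter Topology
open scoped ContDiff

noncomputable section

namespace PeriodicFamily

/-- The `k`-th Fourier coefficient `∫₀¹ f(x) e^{-2πikx} dx` of a `1`-periodic real function. -/
def coeff (f : ℝ → ℝ) (k : ℤ) : ℂ :=
  fourierCoeffOn (zero_lt_one' ℝ) (fun x => (f x : ℂ)) k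

/-- The `k`-th term `(1 + (2πk)²)^s |f̂(k)|²` of the squared `H^s` norm on the circle `ℝ/ℤ`. -/
def sobolevTerm (s : ℝ) (f : ℝ → ℝ) (k : ℤ) : ℝ :=
  (1 + (2 * Real.pi * (k : ℝ)) ^ 2) ^ s * ‖coeff f k‖ ^ 2

/-- Membership in the Sobolev space `H^s` of the circle `ℝ/ℤ` (for `s ≥ 0`); functions on the
circle are `1`-periodic functions on `ℝ`. -/
def MemSobolev (s : ℝ) (f : ℝ → ℝ) : Prop :=
  Function.Periodic f 1 ∧ MemLp f 2 (volume.restrict (Ioc (0 : ℝ) 1)) ∧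
    Summable (sobolevTerm s f)

/-- The norm of `H^s` of the circle. -/
def sobolevNorm (s : ℝ) (f : ℝ → ℝ) : ℝ :=
  Real.sqrt (∑' k : ℤ, sobolevTerm s f k)

/-- `u ∈ C⁰([0,T), H^s)` with `s > 1/2`, where each `u(t, ·)` is the continuous representative
of its class, so that its pointwise values make sense. -/
structure ContinuousInSobolev (s T : ℝ) (u : ℝ → ℝ → ℝ) : Prop where
  mem : ∀ t ∈ Ico 0 T, MemSobolev s (u t)
  continuous_rep : ∀ t ∈ Ico 0 T, Continuous (u t)
  continuous_time : ∀ t₀ ∈ Ico 0 T,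
    Tendsto (fun t => sobolevNorm s (fun x => u t x - u t₀ x)) (𝓝[Ico 0 T] t₀) (𝓝 0)

/-- Smooth test functions on `(0,T) × ℝ/ℤ` whose support is compact in `(0,T) × ℝ/ℤ`. -/
structure IsTestFunction (T : ℝ) (φ : ℝ → ℝ → ℝ) : Prop where
  smooth : ContDiff ℝ ∞ (Function.uncurry φ)
  periodic : ∀ t, Function.Periodic (φ t) 1
  support : ∃ t₀ t₁ : ℝ, 0 < t₀ ∧ t₁ < T ∧ ∀ t, t ∉ Icc t₀ t₁ → ∀ x, φ t x = 0

/-- The equation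
`u_t - u_txx + (b+c) u^p u_x = b u^{p-1} u_x u_xx + c u^p u_xxx`
on `(0,T) × ℝ/ℤ` in the sense of distributions, for `u` that is `C¹` in `x`. The products with
higher derivatives are the distributions
`u^{p-1} u_x u_xx = ∂ₓ(u^{p-1} u_x²)/2 - (p-1)/2 u^{p-2} u_x³` and
`u^p u_xxx = ∂ₓ²(u^p u_x) - (3p/2) ∂ₓ(u^{p-1} u_x²) + (p(p-1)/2) u^{p-2} u_x³`,
and all remaining outer derivatives are moved to the test function. For `p = 1` the term with
the exponent `p - 2` has the coefficient `0`. -/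
def SolvesWeakly (b c : ℝ) (p : ℕ) (T : ℝ) (u : ℝ → ℝ → ℝ) : Prop :=
  ∀ φ : ℝ → ℝ → ℝ, IsTestFunction T φ →
    ∫ t in (0 : ℝ)..T, ∫ x in (0 : ℝ)..1,
      (- u t x * (deriv (fun τ => φ τ x) t
            - iteratedDeriv 2 (fun y => deriv (fun τ => φ τ y) t) x)
        + (b + c) * u t x ^ p * deriv (u t) x * φ t x
        + (b - 3 * p * c) / 2 * (u t x ^ (p - 1) * deriv (u t) x ^ 2) * deriv (φ t) x
        + ((p : ℝ) - 1) * (b - p * c) / 2 * (u t x ^ (p - 2) * deriv (u t) x ^ 3) * φ t x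
        - c * (u t x ^ p * deriv (u t) x) * iteratedDeriv 2 (φ t) x) = 0

/-- The momentum `v - v''` of a function `v` of the space variable. -/
def momentum (v : ℝ → ℝ) (x : ℝ) : ℝ :=
  v x - iteratedDeriv 2 v x

end PeriodicFamily

end

noncomputable section

namespace PeriodicFamily

/-! ### Sobolev embedding on the circle -/

/-! Applying `(1 - ∂ₓ²)⁻¹` turns the equation into `u_t + c u^p u_x + ∂ₓ(1 - ∂ₓ²)⁻¹F = 0` with `F =
b/(p+1) u^{p+1} + (3pc-b)/2 u^{p-1} u_x²`. The remaining cubic term has the factor `(p-1)(b-pc)`,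
which is zero in all three cases. At time `t*` both `u` and `u_x`, hence `F`, vanish on `[x₀, x₁]`,
and `u_t = 0` at the two ends says that `∂ₓ(1 - ∂ₓ²)⁻¹F` vanishes there. Its derivative is `(1 -
∂ₓ²)⁻¹F - F`, so by the mean value theorem `(1 - ∂ₓ²)⁻¹F` has a zero in between. The resolvent has a
strictly positive kernel; if `F` has a sign, then `F = 0` on the whole circle
(`IsEvolution.flux_eq_zero`), and this forces `u(t*, ·) = 0`.

The sign of `F` is where the cases enter. For `p = 1` and `0 ≤ b ≤ 3c` both coefficients are
nonnegative. For `b = pc` and `p` odd only even powers of `u` occur. For `b = pc` and `p` even the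
sign of `F` is that of `u`; it comes from `m = u - u_xx`, which satisfies `m_t + (c u^p m)_x = 0`,
so that the mass of `m` between two characteristics is conserved and `m` keeps its sign
(`IsEvolution.momentum_sign`). A minimum principle passes the sign on to `u`.

It remains to go from one time to all times (`IsEvolution.eq_zero_of_eq_zero`). Along the
characteristics `q' = c u^p` the solution changes by the integral of `-∂ₓ(1 - ∂ₓ²)⁻¹F`, which is
bounded and Lipschitz in space by a multiple of the `C¹` norm of `u`. Grönwall's lemma for that
norm, forwards and backwards in time, gives zero.

The regularity is low, so the nonlocal equation is used integrated in time (`isEvolution_clamp`). It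
is obtained by testing with `χ(t) ψ(x)`, `ψ` a Fourier mode: inverting `1 - ∂ₓ²` is then division by
`1 + κ`, the du Bois-Reymond lemma handles the time variable, and completeness of the Fourier modes
removes `ψ`. -/

lemma coeff_eq_integral (f : ℝ → ℝ) (k : ℤ) :
    coeff f k = ∫ x in (0 : ℝ)..1, Complex.exp (-(2 * Real.pi * Complex.I * k * x)) * f x := by
  rw [coeff, fourierCoeffOn_eq_integral]
  simp only [sub_zero, ne_eq, one_ne_zero, not_false_eq_true, div_self, one_smul]
  refine intervalIntegral.integral_congr fun x _ => ?_
  simp only [smul_eq_mul]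
  rw [fourier_coe_apply]
  congr 2
  push_cast
  ring

lemma coeff_sub {f g : ℝ → ℝ} (hf : Continuous f) (hg : Continuous g) (k : ℤ) :
    coeff (fun x => f x - g x) k = coeff f k - coeff g k := by
  simp only [coeff_eq_integral]
  rw [← intervalIntegral.integral_sub]
  · refine intervalIntegral.integral_congr fun x _ => ?_
    push_cast
    ring
  · exact Continuous.intervalIntegrable (by fun_prop) _ _
  · exact Continuous.intervalIntegrable (by fun_prop) _ _

lemma memSobolev_sub {s : ℝ} {f g : ℝ → ℝ} (hf : MemSobolev s f) (hg : MemSobolev s g)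
    (hfc : Continuous f) (hgc : Continuous g) : MemSobolev s (fun x => f x - g x) := by
  refine ⟨fun x => by simp [hf.1 x, hg.1 x], hf.2.1.sub hg.2.1, ?_⟩
  refine Summable.of_nonneg_of_le (fun k => by unfold sobolevTerm; positivity) (fun k => ?_)
    ((hf.2.2.mul_left 2).add (hg.2.2.mul_left 2))
  unfold sobolevTerm
  rw [coeff_sub hfc hgc]
  have h1 : ‖coeff f k - coeff g k‖ ^ 2 ≤ 2 * ‖coeff f k‖ ^ 2 + 2 * ‖coeff g k‖ ^ 2 := by
    have := norm_sub_le (coeff f k) (coeff g k)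
    nlinarith [norm_nonneg (coeff f k - coeff g k), sq_nonneg (‖coeff f k‖ - ‖coeff g k‖)]
  have h2 : 0 ≤ (1 + (2 * Real.pi * (k : ℝ)) ^ 2) ^ s := by positivity
  nlinarith [mul_le_mul_of_nonneg_left h1 h2]

lemma continuous_periodic_lift {f : ℝ → ℂ} (hp : Function.Periodic f 1) (hf : Continuous f) :
    Continuous (hp.lift : AddCircle (1 : ℝ) → ℂ) :=
  continuous_coinduced_dom.mpr hf

lemma fourierCoeff_lift {f : ℝ → ℝ} (hp : Function.Periodic (fun x => (f x : ℂ)) 1) (k : ℤ) :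
    fourierCoeff (hp.lift : AddCircle (1 : ℝ) → ℂ) k = coeff f k := by
  rw [fourierCoeff_eq_intervalIntegral _ _ 0, coeff_eq_integral]
  simp only [ne_eq, one_ne_zero, not_false_eq_true, div_self, one_smul, zero_add]
  refine intervalIntegral.integral_congr fun x _ => ?_
  simp only [smul_eq_mul]
  rw [fourier_coe_apply, Function.Periodic.lift_coe]
  congr 2
  push_cast
  ring

lemma hasSum_coeff {f : ℝ → ℝ} (hp : Function.Periodic f 1) (hf : Continuous f)
    (hs : Summable fun k => ‖coeff f k‖) (x : ℝ) :
    HasSum (fun k : ℤ => coeff f k * Complex.exp (2 * Real.pi * Complex.I * k * x)) (f x) := by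
  have hp' : Function.Periodic (fun x => (f x : ℂ)) 1 := fun x => by simp [hp x]
  have hc := continuous_periodic_lift hp' (by fun_prop)
  have := has_pointwise_sum_fourier_series_of_summable (f := ⟨_, hc⟩)
    (by
      refine Summable.of_norm ?_
      simpa only [ContinuousMap.coe_mk, fourierCoeff_lift hp'] using hs) (x : AddCircle (1 : ℝ))
  simp only [ContinuousMap.coe_mk, fourierCoeff_lift hp', Function.Periodic.lift_coe,
    fourier_coe_apply, smul_eq_mul, Complex.ofReal_one, div_one] at this
  exact this

/-- A continuous periodic function whose Fourier coefficients all vanish is zero. -/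
lemma eq_zero_of_coeff_eq_zero {f : ℝ → ℝ} (hp : Function.Periodic f 1) (hf : Continuous f)
    (h : ∀ k, coeff f k = 0) (x : ℝ) : f x = 0 := by
  have := hasSum_coeff hp hf (by simp [h]) x
  simp only [h, zero_mul] at this
  exact_mod_cast this.unique hasSum_zero

lemma summable_one_add_sq_rpow {r : ℝ} (hr : r < -1 / 2) :
    Summable fun k : ℤ => (1 + (2 * Real.pi * (k : ℝ)) ^ 2) ^ r := by
  have h1 : Summable fun k : ℤ => |(k : ℝ)| ^ (-(-2 * r)) :=
    Real.summable_abs_int_rpow (by linarith)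
  refine Summable.of_norm_bounded_eventually h1 ?_
  rw [Filter.eventually_cofinite]
  -- The comparison fails at `k = 0`, where the real power `0 ^ (2 * r)` is `0` while the weight is
  -- `1`.
  refine (Set.finite_singleton (0 : ℤ)).subset fun k hk => ?_
  by_contra hk0
  apply hk
  have hk0' : (k : ℝ) ≠ 0 := by exact_mod_cast hk0
  have hpos : 0 < (k : ℝ) ^ 2 := by positivity
  rw [Real.norm_of_nonneg (by positivity)]
  have e : |(k : ℝ)| ^ (-(-2 * r)) = ((k : ℝ) ^ 2) ^ r := by
    rw [← sq_abs, ← Real.rpow_natCast, ← Real.rpow_mul (abs_nonneg _)]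
    congr 1
    push_cast
    ring
  rw [e]
  refine Real.rpow_le_rpow_of_nonpos hpos ?_ (by linarith)
  have hpi : 1 ≤ (2 * Real.pi) ^ 2 := by nlinarith [Real.pi_gt_three]
  rw [mul_pow]
  nlinarith

/-- The square root of the weight sum in the embedding `H^s ⊂ C^n`. -/
def embeddingConst (s : ℝ) (n : ℕ) : ℝ :=
  Real.sqrt (∑' k : ℤ, (1 + (2 * Real.pi * (k : ℝ)) ^ 2) ^ ((n : ℝ) - s))

/-- Cauchy-Schwarz with weight `w = 1 + (2πk)²`: the factor `w^{n/2}` is split as `w^{(n-s)/2}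
w^{s/2}`, and the squares of the first part are summable exactly because `n - s < -1/2`. -/
lemma summable_pow_mul_coeff {s : ℝ} {n : ℕ} (hs : n + 1 / 2 < s) {f : ℝ → ℝ}
    (hf : Summable (sobolevTerm s f)) :
    (Summable fun k : ℤ => |2 * Real.pi * (k : ℝ)| ^ n * ‖coeff f k‖) ∧
      ∑' k : ℤ, |2 * Real.pi * (k : ℝ)| ^ n * ‖coeff f k‖ ≤
        embeddingConst s n * sobolevNorm s f := by
  set w : ℤ → ℝ := fun k => 1 + (2 * Real.pi * (k : ℝ)) ^ 2 with hw
  have hwpos : ∀ k, 0 < w k := fun k => by simp only [hw]; positivity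
  set A : ℤ → ℝ := fun k => (w k) ^ (((n : ℝ) - s) / 2) with hA
  set B : ℤ → ℝ := fun k => (w k) ^ (s / 2) * ‖coeff f k‖ with hB
  have hA2 : ∀ k, A k ^ (2 : ℝ) = w k ^ ((n : ℝ) - s) := fun k => by
    rw [hA, ← Real.rpow_mul (hwpos k).le]
    congr 1
    ring
  have hB2 : ∀ k, B k ^ (2 : ℝ) = sobolevTerm s f k := fun k => by
    rw [hB, Real.mul_rpow (Real.rpow_nonneg (hwpos k).le _) (norm_nonneg _),
      ← Real.rpow_mul (hwpos k).le]
    simp [sobolevTerm, hw]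
  have hAs : Summable fun k => A k ^ (2 : ℝ) := by
    simp only [hA2]
    exact summable_one_add_sq_rpow (by linarith)
  have hBs : Summable fun k => B k ^ (2 : ℝ) := by
    simpa only [hB2] using hf
  have hA0 : ∀ k, 0 ≤ A k := fun k => Real.rpow_nonneg (hwpos k).le _
  have hB0 : ∀ k, 0 ≤ B k := fun k =>
    mul_nonneg (Real.rpow_nonneg (hwpos k).le _) (norm_nonneg _)
  have hle : ∀ k : ℤ, |2 * Real.pi * (k : ℝ)| ^ n * ‖coeff f k‖ ≤ A k * B k := fun k => by
    have e : A k * B k = (w k) ^ ((n : ℝ) / 2) * ‖coeff f k‖ := by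
      simp only [hA, hB]
      rw [← mul_assoc, ← Real.rpow_add (hwpos k)]
      congr 2
      ring
    rw [e]
    refine mul_le_mul_of_nonneg_right ?_ (norm_nonneg _)
    have e2 : (w k) ^ ((n : ℝ) / 2) = (Real.sqrt (w k)) ^ n := by
      rw [Real.sqrt_eq_rpow, ← Real.rpow_natCast, ← Real.rpow_mul (hwpos k).le]
      congr 1
      ring
    rw [e2]
    refine pow_le_pow_left₀ (abs_nonneg _) ?_ _
    exact Real.abs_le_sqrt (by simp only [hw]; linarith)
  have hsum : Summable fun k => A k * B k :=
    Real.summable_mul_of_Lp_Lq_of_nonneg Real.HolderConjugate.two_two hA0 hB0 hAs hBs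
  have h1 := Summable.of_nonneg_of_le (fun k => by positivity) hle hsum
  refine ⟨h1, (h1.tsum_le_tsum hle hsum).trans ?_⟩
  have := Real.inner_le_Lp_mul_Lq_tsum_of_nonneg Real.HolderConjugate.two_two hA0 hB0 hAs hBs
  simpa only [hA2, hB2, embeddingConst, sobolevNorm, Real.sqrt_eq_rpow] using this

/-- The real part of the `n`-th termwise derivative of the Fourier series of `f`. -/
def fourierJet (n : ℕ) (f : ℝ → ℝ) (x : ℝ) : ℝ :=
  (∑' k : ℤ, (2 * Real.pi * Complex.I * k) ^ n * coeff f k *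
    Complex.exp (2 * Real.pi * Complex.I * k * x)).re

lemma norm_jet_term (n : ℕ) (f : ℝ → ℝ) (k : ℤ) (x : ℝ) :
    ‖(2 * Real.pi * Complex.I * k) ^ n * coeff f k *
      Complex.exp (2 * Real.pi * Complex.I * k * x)‖ =
      |2 * Real.pi * (k : ℝ)| ^ n * ‖coeff f k‖ := by
  have h1 : ‖Complex.exp (2 * Real.pi * Complex.I * k * x)‖ = 1 := by
    have : (2 * Real.pi * Complex.I * k * x : ℂ) = ((2 * Real.pi * k * x : ℝ) : ℂ) * Complex.I := by
      push_cast; ring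
    rw [this, Complex.norm_exp_ofReal_mul_I]
  rw [norm_mul, norm_mul, h1, mul_one, norm_pow]
  congr 2
  simp [abs_mul]

/-- Termwise differentiation is allowed because the norms of the differentiated terms do not depend
on `x` and are summable. -/
lemma hasDerivAt_fourierJet {n : ℕ} {f : ℝ → ℝ}
    (h0 : Summable fun k : ℤ => |2 * Real.pi * (k : ℝ)| ^ n * ‖coeff f k‖)
    (h1 : Summable fun k : ℤ => |2 * Real.pi * (k : ℝ)| ^ (n + 1) * ‖coeff f k‖) (x : ℝ) :
    HasDerivAt (fourierJet n f) (fourierJet (n + 1) f x) x := by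
  have key := hasDerivAt_tsum (𝕜 := ℝ) (F := ℂ) (y₀ := x) h1
    (g := fun (k : ℤ) (x : ℝ) => (2 * Real.pi * Complex.I * k) ^ n * coeff f k *
      Complex.exp (2 * Real.pi * Complex.I * k * x))
    (g' := fun (k : ℤ) (x : ℝ) => (2 * Real.pi * Complex.I * k) ^ (n + 1) * coeff f k *
      Complex.exp (2 * Real.pi * Complex.I * k * x))
    (fun k y => by
      have hlin : HasDerivAt (fun x : ℝ => 2 * Real.pi * Complex.I * k * (x : ℂ))
          (2 * Real.pi * Complex.I * k) y := by
        simpa using (Complex.ofRealCLM.hasDerivAt (x := y)).const_mul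
          (2 * Real.pi * Complex.I * k : ℂ)
      convert! (hlin.cexp).const_mul ((2 * Real.pi * Complex.I * k) ^ n * coeff f k) using 1
      ring)
    (fun k y => (norm_jet_term (n + 1) f k y).le)
    (Summable.of_norm (by simpa only [norm_jet_term] using h0)) x
  exact (Complex.reCLM.hasFDerivAt.comp_hasDerivAt x key)

lemma abs_fourierJet_le {n : ℕ} {f : ℝ → ℝ}
    (h0 : Summable fun k : ℤ => |2 * Real.pi * (k : ℝ)| ^ n * ‖coeff f k‖) (x : ℝ) :
    |fourierJet n f x| ≤ ∑' k : ℤ, |2 * Real.pi * (k : ℝ)| ^ n * ‖coeff f k‖ := by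
  refine (Complex.abs_re_le_norm _).trans ?_
  refine tsum_of_norm_bounded h0.hasSum fun k => (norm_jet_term n f k x).le

lemma continuous_fourierJet {n : ℕ} {f : ℝ → ℝ}
    (h0 : Summable fun k : ℤ => |2 * Real.pi * (k : ℝ)| ^ n * ‖coeff f k‖) :
    Continuous (fourierJet n f) := by
  refine Complex.continuous_re.comp ?_
  exact continuous_tsum (fun k => by fun_prop) h0 fun k x => (norm_jet_term n f k x).le

lemma fourierJet_zero {s : ℝ} (hs : 1 / 2 < s) {f : ℝ → ℝ} (hf : MemSobolev s f)
    (hc : Continuous f) : fourierJet 0 f = f := by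
  funext x
  have h0 := (summable_pow_mul_coeff (n := 0) (by simpa using hs) hf.2.2).1
  have := hasSum_coeff hf.1 hc (by simpa using h0) x
  simp only [fourierJet, pow_zero, one_mul, this.tsum_eq, Complex.ofReal_re]

/-- The embedding `H^s ⊂ C^n` for `s > n + 1/2`. -/
lemma iteratedDeriv_eq_fourierJet {s : ℝ} {f : ℝ → ℝ} (hf : MemSobolev s f) (hc : Continuous f)
    {n : ℕ} (hs : n + 1 / 2 < s) : iteratedDeriv n f = fourierJet n f := by
  induction n with
  | zero => rw [iteratedDeriv_zero, fourierJet_zero (by simpa using hs) hf hc]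
  | succ n ih =>
    push_cast at hs
    rw [iteratedDeriv_succ, ih (by linarith)]
    funext x
    exact (hasDerivAt_fourierJet (summable_pow_mul_coeff (by linarith) hf.2.2).1
      (summable_pow_mul_coeff (by push_cast; linarith) hf.2.2).1 x).deriv

lemma continuous_iteratedDeriv_of_memSobolev {s : ℝ} {f : ℝ → ℝ} (hf : MemSobolev s f)
    (hc : Continuous f) {n : ℕ} (hs : n + 1 / 2 < s) : Continuous (iteratedDeriv n f) := by
  rw [iteratedDeriv_eq_fourierJet hf hc hs]
  exact continuous_fourierJet (summable_pow_mul_coeff hs hf.2.2).1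

lemma hasDerivAt_iteratedDeriv_of_memSobolev {s : ℝ} {f : ℝ → ℝ} (hf : MemSobolev s f)
    (hc : Continuous f) {n : ℕ} (hs : (n + 1 : ℕ) + 1 / 2 < s) (x : ℝ) :
    HasDerivAt (iteratedDeriv n f) (iteratedDeriv (n + 1) f x) x := by
  have hs' : n + 1 / 2 < s := by push_cast at hs; linarith
  rw [iteratedDeriv_eq_fourierJet hf hc hs, iteratedDeriv_eq_fourierJet hf hc hs']
  exact hasDerivAt_fourierJet (summable_pow_mul_coeff hs' hf.2.2).1
      (summable_pow_mul_coeff hs hf.2.2).1 x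

lemma abs_iteratedDeriv_le_of_memSobolev {s : ℝ} {f : ℝ → ℝ} (hf : MemSobolev s f)
    (hc : Continuous f) {n : ℕ} (hs : n + 1 / 2 < s) (x : ℝ) :
    |iteratedDeriv n f x| ≤ embeddingConst s n * sobolevNorm s f := by
  rw [iteratedDeriv_eq_fourierJet hf hc hs]
  have := summable_pow_mul_coeff hs hf.2.2
  exact (abs_fourierJet_le this.1 x).trans this.2

lemma contDiff_of_memSobolev {s : ℝ} {f : ℝ → ℝ} (hf : MemSobolev s f)
    (hc : Continuous f) {n : ℕ} (hs : n + 1 / 2 < s) : ContDiff ℝ n f := by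
  rw [contDiff_nat_iff_iteratedDeriv]
  refine ⟨fun m hm => ?_, fun m hm => ?_⟩
  · refine continuous_iteratedDeriv_of_memSobolev hf hc (lt_of_le_of_lt ?_ hs)
    have : (m : ℝ) ≤ n := by exact_mod_cast hm
    linarith
  · intro x
    refine (hasDerivAt_iteratedDeriv_of_memSobolev hf hc (lt_of_le_of_lt ?_ hs)
      x).differentiableAt
    have : ((m + 1 : ℕ) : ℝ) ≤ n := by exact_mod_cast hm
    linarith

lemma iteratedDeriv_sub_of_memSobolev {s : ℝ} {f g : ℝ → ℝ} (hf : MemSobolev s f)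
    (hg : MemSobolev s g) (hfc : Continuous f) (hgc : Continuous g) {n : ℕ}
    (hs : n + 1 / 2 < s) (x : ℝ) :
    iteratedDeriv n (fun x => f x - g x) x = iteratedDeriv n f x - iteratedDeriv n g x :=
  iteratedDeriv_fun_sub (contDiff_of_memSobolev hf hfc hs).contDiffAt
    (contDiff_of_memSobolev hg hgc hs).contDiffAt

/-- Space derivatives of a curve in `H^s` are jointly continuous on `[0, T) × ℝ`. -/
lemma ContinuousInSobolev.continuousOn_iteratedDeriv {s T : ℝ} {u : ℝ → ℝ → ℝ}
    (hu : ContinuousInSobolev s T u) {n : ℕ} (hs : n + 1 / 2 < s) :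
    ContinuousOn (fun z : ℝ × ℝ => iteratedDeriv n (u z.1) z.2) (Ico 0 T ×ˢ univ) := by
  rintro ⟨t₀, x₀⟩ ⟨ht₀, -⟩
  simp only at ht₀
  have h1 : Tendsto (fun z : ℝ × ℝ => iteratedDeriv n (u t₀) z.2)
      (𝓝[Ico 0 T ×ˢ univ] (t₀, x₀)) (𝓝 (iteratedDeriv n (u t₀) x₀)) := by
    have := continuous_iteratedDeriv_of_memSobolev (hu.mem t₀ ht₀) (hu.continuous_rep t₀ ht₀) hs
    exact ((this.comp continuous_snd).tendsto (t₀, x₀)).mono_left nhdsWithin_le_nhds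
  -- The embedding bounds this difference uniformly in space by the `H^s` distance, so joint
  -- continuity needs only continuity in time of the norm and in space at the fixed time `t₀`.
  have h2 : Tendsto (fun z : ℝ × ℝ => iteratedDeriv n (u z.1) z.2 - iteratedDeriv n (u t₀) z.2)
      (𝓝[Ico 0 T ×ˢ univ] (t₀, x₀)) (𝓝 0) := by
    have h3 : Tendsto (fun z : ℝ × ℝ => embeddingConst s n *
        sobolevNorm s (fun x => u z.1 x - u t₀ x))
        (𝓝[Ico 0 T ×ˢ univ] (t₀, x₀)) (𝓝 0) := by
      have := (hu.continuous_time t₀ ht₀).const_mul (embeddingConst s n)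
      rw [mul_zero] at this
      refine this.comp (f := Prod.fst) ?_
      rw [nhdsWithin_prod_eq]
      exact tendsto_fst
    refine squeeze_zero_norm' ?_ h3
    filter_upwards [self_mem_nhdsWithin] with z hz
    have hz1 : z.1 ∈ Ico 0 T := hz.1
    rw [Real.norm_eq_abs, ← iteratedDeriv_sub_of_memSobolev (hu.mem _ hz1) (hu.mem _ ht₀)
      (hu.continuous_rep _ hz1) (hu.continuous_rep _ ht₀) hs]
    exact abs_iteratedDeriv_le_of_memSobolev (memSobolev_sub (hu.mem _ hz1) (hu.mem _ ht₀)
      (hu.continuous_rep _ hz1) (hu.continuous_rep _ ht₀))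
      ((hu.continuous_rep _ hz1).sub (hu.continuous_rep _ ht₀)) hs z.2
  have := h1.add h2
  simp only [add_zero] at this
  refine this.congr fun z => ?_
  ring

/-! ### The resolvent `(1 - ∂ₓ²)⁻¹` -/

/-- The exponentially weighted mean of `f` to the right of `x`. -/
def expRight (f : ℝ → ℝ) (x : ℝ) : ℝ := ∫ r in Ioi (0 : ℝ), Real.exp (-r) * f (x + r)

/-- The exponentially weighted mean of `f` to the left of `x`. -/
def expLeft (f : ℝ → ℝ) (x : ℝ) : ℝ := expRight (fun y => f (-y)) (-x)

/-- The convolution `e^{-|·|} ∗ f / 2`, the bounded solution `g` of `g - g'' = f`. -/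
def resolvent (f : ℝ → ℝ) (x : ℝ) : ℝ := (expRight f x + expLeft f x) / 2

/-- The derivative of `resolvent f`. -/
def resolventDeriv (f : ℝ → ℝ) (x : ℝ) : ℝ := (expRight f x - expLeft f x) / 2

lemma integrableOn_exp_mul {f : ℝ → ℝ} (hf : Continuous f) {M : ℝ} (hM : ∀ x, |f x| ≤ M) (x : ℝ) :
    IntegrableOn (fun r => Real.exp (-r) * f (x + r)) (Ioi 0) := by
  refine Integrable.mono' ((integrableOn_exp_neg_Ioi 0).mul_const M) ?_ ?_
  · exact (by fun_prop : Continuous fun r => Real.exp (-r) * f (x + r)).aestronglyMeasurable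
  · refine Eventually.of_forall fun r => ?_
    rw [norm_mul, Real.norm_of_nonneg (Real.exp_pos _).le]
    exact mul_le_mul_of_nonneg_left (hM _) (Real.exp_pos _).le

lemma abs_expRight_le {f : ℝ → ℝ} {M : ℝ} (hM : ∀ x, |f x| ≤ M) (x : ℝ) :
    |expRight f x| ≤ M := by
  have := norm_integral_le_of_norm_le (μ := volume.restrict (Ioi (0 : ℝ)))
    (f := fun r => Real.exp (-r) * f (x + r)) (g := fun r => Real.exp (-r) * M)
    ((integrableOn_exp_neg_Ioi 0).mul_const M) (Eventually.of_forall fun r => by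
      rw [norm_mul, Real.norm_of_nonneg (Real.exp_pos _).le]
      exact mul_le_mul_of_nonneg_left (hM _) (Real.exp_pos _).le)
  rw [integral_mul_const, integral_exp_neg_Ioi_zero, one_mul] at this
  exact this

lemma abs_expLeft_le {f : ℝ → ℝ} {M : ℝ} (hM : ∀ x, |f x| ≤ M) (x : ℝ) :
    |expLeft f x| ≤ M :=
  abs_expRight_le (fun _ => hM _) _

/-- The substitution `y = x + r` moves `x` out of the argument of `f` and into the limit of
integration, so that a merely continuous `f` gives a differentiable mean. -/
lemma expRight_eq {f : ℝ → ℝ} (hf : Continuous f) {M : ℝ} (hM : ∀ x, |f x| ≤ M) (x : ℝ) :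
    expRight f x =
      Real.exp x * (expRight f 0 - ∫ y in (0 : ℝ)..x, Real.exp (-y) * f y) := by
  have hint : ∀ a, IntegrableOn (fun y => Real.exp (-y) * f y) (Ioi a) := fun a => by
    refine Integrable.mono' ((integrableOn_exp_neg_Ioi a).mul_const M) ?_ ?_
    · exact (by fun_prop : Continuous fun r => Real.exp (-r) * f r).aestronglyMeasurable
    · refine Eventually.of_forall fun r => ?_
      rw [norm_mul, Real.norm_of_nonneg (Real.exp_pos _).le]
      exact mul_le_mul_of_nonneg_left (hM _) (Real.exp_pos _).le
  have h1 : ∀ x, expRight f x = Real.exp x * ∫ y in Ioi x, Real.exp (-y) * f y := fun x => by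
    have := (measurePreserving_add_left volume x).setIntegral_preimage_emb
      (measurableEmbedding_addLeft x) (fun y => Real.exp (-y) * f y) (Ioi x)
    rw [preimage_const_add_Ioi, sub_self] at this
    rw [← this, expRight, ← integral_const_mul]
    refine integral_congr_ae (Eventually.of_forall fun r => ?_)
    simp only
    rw [← mul_assoc, ← Real.exp_add]
    congr 2
    ring
  rw [h1 x, h1 0, Real.exp_zero, one_mul,
    ← intervalIntegral.integral_Ioi_sub_Ioi' (hint 0) (hint x)]
  ring

lemma hasDerivAt_expRight {f : ℝ → ℝ} (hf : Continuous f) {M : ℝ} (hM : ∀ x, |f x| ≤ M) (x : ℝ) :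
    HasDerivAt (expRight f) (expRight f x - f x) x := by
  rw [funext (expRight_eq hf hM)]
  have h1 : HasDerivAt (fun x => ∫ y in (0 : ℝ)..x, Real.exp (-y) * f y)
      (Real.exp (-x) * f x) x :=
    (by fun_prop : Continuous fun y => Real.exp (-y) * f y).integral_hasStrictDerivAt 0 x
      |>.hasDerivAt
  convert! (Real.hasDerivAt_exp x).mul (h1.const_sub (expRight f 0)) using 1
  have : Real.exp x * Real.exp (-x) = 1 := by rw [← Real.exp_add]; simp
  linear_combination f x * this

lemma hasDerivAt_expLeft {f : ℝ → ℝ} (hf : Continuous f) {M : ℝ} (hM : ∀ x, |f x| ≤ M) (x : ℝ) :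
    HasDerivAt (expLeft f) (f x - expLeft f x) x := by
  have h := hasDerivAt_expRight (f := fun y => f (-y)) (by fun_prop) (fun _ => hM _) (-x)
  have := h.comp x (hasDerivAt_neg x)
  convert! this using 1
  simp only [expLeft, neg_neg]
  ring

lemma hasDerivAt_resolvent {f : ℝ → ℝ} (hf : Continuous f) {M : ℝ} (hM : ∀ x, |f x| ≤ M) (x : ℝ) :
    HasDerivAt (resolvent f) (resolventDeriv f x) x := by
  convert! ((hasDerivAt_expRight hf hM x).add (hasDerivAt_expLeft hf hM x)).div_const 2 using 1
  simp only [resolventDeriv]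
  ring

/-- The factorization of `1 - ∂ₓ²` into first-order operators: the right mean solves `g' = g - f`
and the left mean solves `g' = f - g`. -/
lemma hasDerivAt_resolventDeriv {f : ℝ → ℝ} (hf : Continuous f) {M : ℝ} (hM : ∀ x, |f x| ≤ M)
    (x : ℝ) : HasDerivAt (resolventDeriv f) (resolvent f x - f x) x := by
  convert! ((hasDerivAt_expRight hf hM x).sub (hasDerivAt_expLeft hf hM x)).div_const 2 using 1
  simp only [resolvent]
  ring

lemma abs_resolvent_le {f : ℝ → ℝ} {M : ℝ} (hM : ∀ x, |f x| ≤ M) (x : ℝ) :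
    |resolvent f x| ≤ M := by
  have h1 := abs_le.mp (abs_expRight_le hM x)
  have h2 := abs_le.mp (abs_expLeft_le hM x)
  rw [resolvent, abs_le]
  constructor <;> linarith

lemma abs_resolventDeriv_le {f : ℝ → ℝ} {M : ℝ} (hM : ∀ x, |f x| ≤ M) (x : ℝ) :
    |resolventDeriv f x| ≤ M := by
  have h1 := abs_le.mp (abs_expRight_le hM x)
  have h2 := abs_le.mp (abs_expLeft_le hM x)
  rw [resolventDeriv, abs_le]
  constructor <;> linarith

lemma periodic_expRight {f : ℝ → ℝ} (hp : Function.Periodic f 1) :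
    Function.Periodic (expRight f) 1 := fun x => by
  unfold expRight
  refine integral_congr_ae (Eventually.of_forall fun r => ?_)
  simp only
  rw [add_right_comm, hp]

lemma periodic_expLeft {f : ℝ → ℝ} (hp : Function.Periodic f 1) :
    Function.Periodic (expLeft f) 1 := fun x => by
  have hp' : Function.Periodic (fun y => f (-y)) 1 := fun y => by
    simp only
    rw [neg_add, ← sub_eq_add_neg, hp.sub_eq]
  unfold expLeft
  rw [neg_add, ← sub_eq_add_neg, (periodic_expRight hp').sub_eq]

lemma periodic_resolvent {f : ℝ → ℝ} (hp : Function.Periodic f 1) :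
    Function.Periodic (resolvent f) 1 := fun x => by
  simp only [resolvent, periodic_expRight hp x, periodic_expLeft hp x]

lemma periodic_resolventDeriv {f : ℝ → ℝ} (hp : Function.Periodic f 1) :
    Function.Periodic (resolventDeriv f) 1 := fun x => by
  simp only [resolventDeriv, periodic_expRight hp x, periodic_expLeft hp x]

lemma continuous_uncurry_expRight {F : ℝ → ℝ → ℝ} (hF : Continuous (Function.uncurry F)) {M : ℝ}
    (hM : ∀ t x, |F t x| ≤ M) : Continuous (fun z : ℝ × ℝ => expRight (F z.1) z.2) := by
  unfold expRight
  refine continuous_of_dominated (bound := fun r => Real.exp (-r) * M) ?_ ?_ ?_ ?_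
  · intro z
    have : Continuous (fun r => F z.1 (z.2 + r)) := hF.comp (f := fun r => (z.1, z.2 + r)) (by fun_prop)
    exact (by fun_prop : Continuous fun r => Real.exp (-r) * F z.1 (z.2 + r)).aestronglyMeasurable
  · intro z
    refine Eventually.of_forall fun r => ?_
    rw [norm_mul, Real.norm_of_nonneg (Real.exp_pos _).le]
    exact mul_le_mul_of_nonneg_left (hM _ _) (Real.exp_pos _).le
  · exact (integrableOn_exp_neg_Ioi 0).mul_const M
  · refine Eventually.of_forall fun r => ?_
    have : Continuous (fun z : ℝ × ℝ => F z.1 (z.2 + r)) :=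
      hF.comp (f := fun z : ℝ × ℝ => (z.1, z.2 + r)) (by fun_prop)
    exact continuous_const.mul this

lemma continuous_uncurry_expLeft {F : ℝ → ℝ → ℝ} (hF : Continuous (Function.uncurry F)) {M : ℝ}
    (hM : ∀ t x, |F t x| ≤ M) : Continuous (fun z : ℝ × ℝ => expLeft (F z.1) z.2) := by
  have h := continuous_uncurry_expRight (F := fun t x => F t (-x))
    (hF.comp (f := fun z : ℝ × ℝ => (z.1, -z.2)) (by fun_prop)) (fun t x => hM t (-x))
  exact h.comp (f := fun z : ℝ × ℝ => (z.1, -z.2)) (by fun_prop)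

lemma continuous_uncurry_resolvent {F : ℝ → ℝ → ℝ} (hF : Continuous (Function.uncurry F)) {M : ℝ}
    (hM : ∀ t x, |F t x| ≤ M) : Continuous (fun z : ℝ × ℝ => resolvent (F z.1) z.2) :=
  ((continuous_uncurry_expRight hF hM).add (continuous_uncurry_expLeft hF hM)).div_const 2

lemma continuous_uncurry_resolventDeriv {F : ℝ → ℝ → ℝ} (hF : Continuous (Function.uncurry F))
    {M : ℝ} (hM : ∀ t x, |F t x| ≤ M) :
    Continuous (fun z : ℝ × ℝ => resolventDeriv (F z.1) z.2) :=
  ((continuous_uncurry_expRight hF hM).sub (continuous_uncurry_expLeft hF hM)).div_const 2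

lemma expRight_nonneg {f : ℝ → ℝ} (h : ∀ x, 0 ≤ f x) (x : ℝ) : 0 ≤ expRight f x :=
  integral_nonneg fun _ => mul_nonneg (Real.exp_pos _).le (h _)

lemma expLeft_nonneg {f : ℝ → ℝ} (h : ∀ x, 0 ≤ f x) (x : ℝ) : 0 ≤ expLeft f x :=
  expRight_nonneg (fun _ => h _) _

/-- Strong maximum principle for the resolvent. -/
lemma eq_zero_of_resolvent_eq_zero {f : ℝ → ℝ} (hf : Continuous f) {M : ℝ}
    (hM : ∀ x, |f x| ≤ M) (hp : Function.Periodic f 1) (h : ∀ x, 0 ≤ f x) {x : ℝ}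
    (hx : resolvent f x = 0) (y : ℝ) : f y = 0 := by
  have h0 : expRight f x = 0 := by
    have h1 := expRight_nonneg h x
    have h2 := expLeft_nonneg h x
    rw [resolvent] at hx
    linarith
  have h1 := (setIntegral_eq_zero_iff_of_nonneg_ae
    (Eventually.of_forall fun r => mul_nonneg (Real.exp_pos _).le (h _))
    (integrableOn_exp_mul hf hM x)).mp h0
  have h2 := Measure.eqOn_open_of_ae_eq h1 isOpen_Ioi
    (by fun_prop : Continuous fun r => Real.exp (-r) * f (x + r)).continuousOn continuousOn_const
  -- The vanishing of the right mean only controls `f` to the right of `x`; a translate of `y` by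
  -- whole periods lies there.
  obtain ⟨n, hn⟩ := exists_nat_gt (x - y)
  have h3 := h2 (show (y + n - x) ∈ Ioi 0 by simp only [mem_Ioi]; linarith)
  simp only [Pi.zero_apply, mul_eq_zero, Real.exp_ne_zero, false_or] at h3
  rw [add_sub_cancel] at h3
  rw [← h3]
  simpa using (hp.nat_mul n y).symm

/-- If a nonnegative periodic `f` vanishes on an interval and the derivative of its resolvent
vanishes at both ends, then `f = 0`. -/
lemma eq_zero_of_resolventDeriv_eq_zero {f : ℝ → ℝ} (hf : Continuous f) {M : ℝ}
    (hM : ∀ x, |f x| ≤ M) (hp : Function.Periodic f 1) (h : ∀ x, 0 ≤ f x) {x₀ x₁ : ℝ}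
    (hx : x₀ < x₁) (hz : ∀ x ∈ Icc x₀ x₁, f x = 0) (h₀ : resolventDeriv f x₀ = 0)
    (h₁ : resolventDeriv f x₁ = 0) (y : ℝ) : f y = 0 := by
  obtain ⟨ξ, hξ, hslope⟩ := exists_hasDerivAt_eq_slope (resolventDeriv f)
    (fun x => resolvent f x - f x) hx
    (fun x _ => (hasDerivAt_resolventDeriv hf hM x).continuousAt.continuousWithinAt)
    (fun x _ => hasDerivAt_resolventDeriv hf hM x)
  simp only [h₀, h₁, hz ξ (Ioo_subset_Icc_self hξ), sub_zero, zero_div] at hslope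
  exact eq_zero_of_resolvent_eq_zero hf hM hp h hslope y

/-! ### Weak derivatives on an interval -/

lemma exists_Icc_of_isCompact_subset_Ioo {K : Set ℝ} (hK : IsCompact K) {a b : ℝ} (hab : a < b)
    (h : K ⊆ Ioo a b) : ∃ a' b', a < a' ∧ b' < b ∧ K ⊆ Icc a' b' := by
  rcases K.eq_empty_or_nonempty with rfl | hne
  · exact ⟨b, a, hab, hab, empty_subset _⟩
  · obtain ⟨m, hm⟩ := hK.exists_isLeast hne
    obtain ⟨n, hn⟩ := hK.exists_isGreatest hne
    exact ⟨m, n, (h hm.1).1, (h hn.1).2, fun x hx => ⟨hm.2 hx, hn.2 hx⟩⟩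

lemma integral_eq_interval_of_support {f : ℝ → ℝ} {a b a' b' : ℝ} (ha : a < a') (hb : b' < b)
    (hab : a ≤ b) (h : ∀ t, t ∉ Icc a' b' → f t = 0) : ∫ t, f t = ∫ t in a..b, f t := by
  rw [intervalIntegral.integral_of_le hab]
  symm
  refine setIntegral_eq_integral_of_forall_compl_eq_zero fun t ht => h t fun h' => ht ?_
  exact ⟨ha.trans_le h'.1, h'.2.trans hb.le⟩

/-- A primitive, with the same kind of support, of a smooth function of mean zero. -/
lemma exists_primitive_of_integral_eq_zero {f : ℝ → ℝ} (hf : ContDiff ℝ ∞ f) {a b a' b' : ℝ}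
    (ha : a < a') (hb : b' < b) (h : ∀ t, t ∉ Icc a' b' → f t = 0)
    (h0 : ∫ t in a..b, f t = 0) :
    ∃ χ : ℝ → ℝ, ContDiff ℝ ∞ χ ∧ (∀ t, HasDerivAt χ (f t) t) ∧
      ∀ t, t ∉ Icc a' b' → χ t = 0 := by
  have hd : ∀ t, HasDerivAt (fun t => ∫ s in a..t, f s) (f t) t := fun t =>
    (hf.continuous.integral_hasStrictDerivAt a t).hasDerivAt
  refine ⟨fun t => ∫ s in a..t, f s, ?_, hd, fun t ht => ?_⟩
  · rw [contDiff_infty_iff_deriv]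
    refine ⟨fun t => (hd t).differentiableAt, ?_⟩
    rwa [show deriv (fun t => ∫ s in a..t, f s) = f from funext fun t => (hd t).deriv]
  · by_cases hta : t < a'
    · refine intervalIntegral.integral_zero_ae (Eventually.of_forall fun s hs => h s fun hs' => ?_)
      rw [mem_uIoc] at hs
      rcases hs with hs | hs <;> linarith [hs.1, hs.2, hs'.1]
    · have htb : b' < t := by
        by_contra! hcon
        exact ht ⟨not_lt.mp hta, hcon⟩
      have h1 : ∫ s in b..t, f s = 0 := by
        refine intervalIntegral.integral_zero_ae
          (Eventually.of_forall fun s hs => h s fun hs' => ?_)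
        rw [mem_uIoc] at hs
        rcases hs with hs | hs <;> linarith [hs.1, hs.2, hs'.2]
      have h2 := intervalIntegral.integral_add_adjacent_intervals
        (hf.continuous.intervalIntegrable (μ := volume) a b)
        (hf.continuous.intervalIntegrable (μ := volume) b t)
      simp only
      rw [← h2, h0, h1, add_zero]

/-- The du Bois-Reymond lemma. -/
lemma eq_of_integral_mul_deriv_eq_zero {H : ℝ → ℝ} (hH : Continuous H) {a b : ℝ} (hab : a < b)
    (h : ∀ χ : ℝ → ℝ, ContDiff ℝ ∞ χ →
      (∃ a' b', a < a' ∧ b' < b ∧ ∀ t, t ∉ Icc a' b' → χ t = 0) →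
      ∫ t in a..b, H t * deriv χ t = 0) : ∃ C, ∀ t ∈ Icc a b, H t = C := by
  obtain ⟨δ, hδ⟩ : ∃ δ, δ = (b - a) / 4 := ⟨_, rfl⟩
  -- The outer radius is `3(b - a)/8`, less than half the length of the interval, so the support
  -- stays inside the open interval.
  let φ : ContDiffBump ((a + b) / 2) := ⟨δ, 2 * δ * (3 / 4), by linarith, by linarith⟩
  let η : ℝ → ℝ := φ.normed volume
  have hηs : ContDiff ℝ ∞ η := φ.contDiff_normed
  have hη1 : ∫ t, η t = 1 := φ.integral_normed
  have hηsupp : tsupport η ⊆ Ioo a b := by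
    rw [φ.tsupport_normed_eq]
    intro t ht
    rw [Metric.mem_closedBall, Real.dist_eq, abs_le] at ht
    change _ ≤ _ ∧ _ ≤ 2 * δ * (3 / 4) at ht
    constructor
    · have h1 : -(2 * δ * (3 / 4)) ≤ t - (a + b) / 2 := ht.1
      linarith
    · linarith [ht.2]
  obtain ⟨a₁, b₁, ha₁, hb₁, hη⟩ :=
    exists_Icc_of_isCompact_subset_Ioo φ.hasCompactSupport_normed hab hηsupp
  have hη0 : ∀ t, t ∉ Icc a₁ b₁ → η t = 0 := fun t ht =>
    image_eq_zero_of_notMem_tsupport fun h' => ht (hη h')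
  have hη1' : ∫ t in a..b, η t = 1 := by
    rw [← integral_eq_interval_of_support ha₁ hb₁ hab.le hη0, hη1]
  set C := ∫ t in a..b, H t * η t with hC
  have hae := isOpen_Ioo.ae_eq_zero_of_integral_contDiff_smul_eq_zero (μ := volume)
    (f := fun t => H t - C) (U := Ioo a b)
    ((hH.sub continuous_const).locallyIntegrable.locallyIntegrableOn _)
    (fun θ hθs hθc hθ => by
      obtain ⟨a₂, b₂, ha₂, hb₂, hθ'⟩ := exists_Icc_of_isCompact_subset_Ioo hθc hab hθ
      have hθ0 : ∀ t, t ∉ Icc a₂ b₂ → θ t = 0 := fun t ht =>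
        image_eq_zero_of_notMem_tsupport fun h' => ht (hθ' h')
      rw [integral_eq_interval_of_support ha₂ hb₂ hab.le
        (fun t ht => by simp [hθ0 t ht])]
      -- Subtracting `I * η` from `θ` makes its mean zero, so the difference is the derivative of an
      -- admissible test function; what is left over is the constant `C`.
      set I := ∫ t in a..b, θ t with hI
      have hcθ := hθs.continuous
      have hcη := hηs.continuous
      have hζ0 : ∀ t, t ∉ Icc (min a₁ a₂) (max b₁ b₂) → θ t - I * η t = 0 := fun t ht => by
        rw [hθ0 t fun h' => ht ⟨(min_le_right _ _).trans h'.1, h'.2.trans (le_max_right _ _)⟩,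
          hη0 t fun h' => ht ⟨(min_le_left _ _).trans h'.1, h'.2.trans (le_max_left _ _)⟩]
        simp
      obtain ⟨χ, hχs, hχd, hχ0⟩ := exists_primitive_of_integral_eq_zero
        (f := fun t => θ t - I * η t) (hθs.sub (contDiff_const.mul hηs))
        (lt_min ha₁ ha₂) (max_lt hb₁ hb₂) hζ0 (by
          rw [intervalIntegral.integral_sub (hcθ.intervalIntegrable _ _)
            (Continuous.intervalIntegrable (by fun_prop) _ _),
            intervalIntegral.integral_const_mul, hη1', mul_one, sub_self])
      have := h χ hχs ⟨_, _, lt_min ha₁ ha₂, max_lt hb₁ hb₂, hχ0⟩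
      simp only [(hχd _).deriv] at this
      have e1 : ∫ t in a..b, H t * (θ t - I * η t) =
          (∫ t in a..b, H t * θ t) - I * ∫ t in a..b, H t * η t := by
        rw [← intervalIntegral.integral_const_mul, ← intervalIntegral.integral_sub
          (Continuous.intervalIntegrable (by fun_prop) _ _)
          (Continuous.intervalIntegrable (by fun_prop) _ _)]
        refine intervalIntegral.integral_congr fun t _ => ?_
        ring
      have e2 : ∫ t in a..b, θ t • (H t - C) =
          (∫ t in a..b, H t * θ t) - I * C := by
        rw [hI, ← intervalIntegral.integral_mul_const, ← intervalIntegral.integral_sub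
          (Continuous.intervalIntegrable (by fun_prop) _ _)
          (Continuous.intervalIntegrable (by fun_prop) _ _)]
        refine intervalIntegral.integral_congr fun t _ => ?_
        simp only [smul_eq_mul]
        ring
      rw [e2, ← this, e1])
  refine ⟨C, ?_⟩
  have hEq : EqOn H (fun _ => C) (Ioo a b) := by
    refine Measure.eqOn_open_of_ae_eq (μ := volume) ?_ isOpen_Ioo hH.continuousOn
      continuousOn_const
    rw [EventuallyEq, ae_restrict_iff' measurableSet_Ioo]
    filter_upwards [hae] with t ht ht'
    linarith [ht ht']
  have := hEq.closure hH continuous_const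
  rwa [closure_Ioo hab.ne] at this

/-- A continuous function with a continuous weak derivative on an interval is the integral of the
latter. -/
lemma sub_eq_neg_integral_of_weak {h k : ℝ → ℝ} (hh : Continuous h) (hk : Continuous k) {a b : ℝ}
    (hab : a < b) (hw : ∀ χ : ℝ → ℝ, ContDiff ℝ ∞ χ →
      (∃ a' b', a < a' ∧ b' < b ∧ ∀ t, t ∉ Icc a' b' → χ t = 0) →
      ∫ t in a..b, (-h t * deriv χ t + k t * χ t) = 0)
    {t₀ t : ℝ} (ht₀ : t₀ ∈ Icc a b) (ht : t ∈ Icc a b) :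
    h t - h t₀ = -∫ τ in t₀..t, k τ := by
  have hd : ∀ t, HasDerivAt (fun t => ∫ s in a..t, k s) (k t) t := fun t =>
    (hk.integral_hasStrictDerivAt a t).hasDerivAt
  have hKc : Continuous (fun t => ∫ s in a..t, k s) :=
    continuous_iff_continuousAt.mpr fun t => (hd t).continuousAt
  -- Integrating `k * χ` by parts shows that `h` plus a primitive of `k` has weak derivative zero.
  obtain ⟨C, hC⟩ := eq_of_integral_mul_deriv_eq_zero
    (H := fun t => h t + ∫ s in a..t, k s) (hh.add hKc) hab (fun χ hχ hsupp => by
      have hcχ := hχ.continuous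
      have hcχ' : Continuous (deriv χ) := hχ.continuous_deriv (by simp)
      have hdχ : ∀ t, HasDerivAt χ (deriv χ t) t := fun t =>
        (hχ.differentiable (by simp) t).hasDerivAt
      have h1 := hw χ hχ hsupp
      obtain ⟨a', b', ha', hb', h0⟩ := hsupp
      have hχa : χ a = 0 := h0 a fun h' => by linarith [h'.1]
      have hχb : χ b = 0 := h0 b fun h' => by linarith [h'.2]
      have h2 := intervalIntegral.integral_mul_deriv_eq_deriv_mul
        (fun t _ => hd t) (fun t _ => hdχ t)
        (hk.intervalIntegrable (μ := volume) a b) (hcχ'.intervalIntegrable (μ := volume) a b)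
      rw [hχa, hχb, mul_zero, mul_zero, sub_zero, zero_sub] at h2
      rw [intervalIntegral.integral_add (Continuous.intervalIntegrable (by fun_prop) _ _)
        (Continuous.intervalIntegrable (by fun_prop) _ _)] at h1
      simp only [neg_mul, intervalIntegral.integral_neg] at h1
      simp only [add_mul]
      rw [intervalIntegral.integral_add (Continuous.intervalIntegrable (by fun_prop) _ _)
        (Continuous.intervalIntegrable (show Continuous
          (fun t => (∫ s in a..t, k s) * deriv χ t) from hKc.mul hcχ') _ _), h2]
      linarith)
  have e1 := hC t ht
  have e2 := hC t₀ ht₀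
  have e3 := intervalIntegral.integral_interval_sub_left (hk.intervalIntegrable (μ := volume) a t)
    (hk.intervalIntegrable (μ := volume) a t₀)
  rw [← e3]
  linarith

/-! ### From the weak equation to the integrated nonlocal equation -/

/-- A bounded jointly continuous family of periodic `C¹` functions `v t` with derivatives `w t`. -/
structure IsC1Family (v w : ℝ → ℝ → ℝ) : Prop where
  cont : Continuous (Function.uncurry v)
  cont_deriv : Continuous (Function.uncurry w)
  hasDerivAt : ∀ t x, HasDerivAt (v t) (w t x) x
  periodic : ∀ t, Function.Periodic (v t) 1
  bounded : ∃ M, ∀ t x, |v t x| ≤ M ∧ |w t x| ≤ M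

/-- The quantity `F` in the nonlocal form `u_t + c u^p u_x + ∂ₓ(1 - ∂ₓ²)⁻¹F = 0`. -/
def flux (b c : ℝ) (p : ℕ) (y z : ℝ) : ℝ :=
  b / (p + 1) * y ^ (p + 1) + (3 * p * c - b) / 2 * (y ^ (p - 1) * z ^ 2)

/-- The negative time derivative in the nonlocal form. -/
def drift (b c : ℝ) (p : ℕ) (v w : ℝ → ℝ → ℝ) (t x : ℝ) : ℝ :=
  c * (v t x ^ p * w t x) + resolventDeriv (fun y => flux b c p (v t y) (w t y)) x

lemma hasDerivAt_periodic {f f' : ℝ → ℝ} (hf : ∀ x, HasDerivAt f (f' x) x)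
    (hp : Function.Periodic f 1) : Function.Periodic f' 1 := fun x => by
  have h1 : HasDerivAt (fun y => f (y + 1)) (f' (x + 1)) x := (hf (x + 1)).comp_add_const x 1
  rw [show (fun y => f (y + 1)) = f from funext hp] at h1
  exact h1.unique (hf x)

namespace IsC1Family

variable {v w : ℝ → ℝ → ℝ}

lemma continuous_left (h : IsC1Family v w) (t : ℝ) : Continuous (v t) :=
  h.cont.comp (f := fun x => (t, x)) (by fun_prop)

lemma continuous_deriv_left (h : IsC1Family v w) (t : ℝ) : Continuous (w t) :=
  h.cont_deriv.comp (f := fun x => (t, x)) (by fun_prop)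

lemma periodic_deriv (h : IsC1Family v w) (t : ℝ) : Function.Periodic (w t) 1 :=
  hasDerivAt_periodic (h.hasDerivAt t) (h.periodic t)

lemma continuous_flux (h : IsC1Family v w) (b c : ℝ) (p : ℕ) :
    Continuous (Function.uncurry fun t x => flux b c p (v t x) (w t x)) := by
  have h1 := h.cont
  have h2 := h.cont_deriv
  simp only [Function.uncurry_def] at *
  unfold flux
  fun_prop

lemma continuous_flux_left (h : IsC1Family v w) (b c : ℝ) (p : ℕ) (t : ℝ) :
    Continuous fun x => flux b c p (v t x) (w t x) :=
  (h.continuous_flux b c p).comp (f := fun x => (t, x)) (by fun_prop)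

lemma periodic_flux (h : IsC1Family v w) (b c : ℝ) (p : ℕ) (t : ℝ) :
    Function.Periodic (fun x => flux b c p (v t x) (w t x)) 1 := fun x => by
  simp only [h.periodic t x, h.periodic_deriv t x]

/-- The flux is homogeneous of degree `p + 1`. Bounding `p` factors by `M` leaves one factor, so the
estimate is linear in the `C¹` norm, as Grönwall's lemma requires. -/
lemma abs_flux_le {b c M y z : ℝ} {p : ℕ} (hp : 0 < p) (hy : |y| ≤ M) (hz : |z| ≤ M) :
    |flux b c p y z| ≤ (|b / (p + 1)| + |(3 * p * c - b) / 2|) * M ^ p * max |y| |z| := by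
  have hM : 0 ≤ M := (abs_nonneg y).trans hy
  have hmax : 0 ≤ max |y| |z| := (abs_nonneg y).trans (le_max_left _ _)
  have h1 : |y ^ (p + 1)| ≤ M ^ p * max |y| |z| := by
    rw [abs_pow, pow_succ]
    exact mul_le_mul (pow_le_pow_left₀ (abs_nonneg _) hy _) (le_max_left _ _) (abs_nonneg _)
      (by positivity)
  have h2 : |y ^ (p - 1) * z ^ 2| ≤ M ^ p * max |y| |z| := by
    have e : M ^ p = M ^ (p - 1) * M := by
      rw [← pow_succ, Nat.sub_add_cancel hp]
    rw [e, abs_mul, abs_pow, abs_pow, mul_assoc, sq]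
    refine mul_le_mul (pow_le_pow_left₀ (abs_nonneg _) hy _) ?_ (by positivity) (by positivity)
    exact mul_le_mul hz (le_max_right _ _) (abs_nonneg _) hM
  unfold flux
  refine (abs_add_le _ _).trans ?_
  rw [abs_mul, abs_mul]
  have h3 := mul_le_mul_of_nonneg_left h1 (abs_nonneg (b / ((p : ℝ) + 1)))
  have h4 := mul_le_mul_of_nonneg_left h2 (abs_nonneg ((3 * p * c - b) / 2))
  linarith

lemma exists_flux_bound (h : IsC1Family v w) (b c : ℝ) {p : ℕ} (hp : 0 < p) :
    ∃ M, ∀ t x, |flux b c p (v t x) (w t x)| ≤ M := by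
  obtain ⟨M, hM⟩ := h.bounded
  have hM0 : 0 ≤ M := (abs_nonneg _).trans (hM 0 0).1
  refine ⟨(|b / (p + 1)| + |(3 * p * c - b) / 2|) * M ^ p * M, fun t x => ?_⟩
  refine (abs_flux_le hp (hM t x).1 (hM t x).2).trans ?_
  exact mul_le_mul_of_nonneg_left (max_le (hM t x).1 (hM t x).2) (by positivity)

lemma continuous_drift (h : IsC1Family v w) (b c : ℝ) {p : ℕ} (hp : 0 < p) :
    Continuous (Function.uncurry (drift b c p v w)) := by
  obtain ⟨M, hM⟩ := h.exists_flux_bound b c hp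
  have h1 := h.cont
  have h2 := h.cont_deriv
  have h3 := continuous_uncurry_resolventDeriv (h.continuous_flux b c p) hM
  simp only [Function.uncurry_def] at *
  unfold drift
  fun_prop

lemma periodic_drift (h : IsC1Family v w) (b c : ℝ) (p : ℕ) (t : ℝ) :
    Function.Periodic (drift b c p v w t) 1 := fun x => by
  simp only [drift, h.periodic t x, h.periodic_deriv t x,
    periodic_resolventDeriv (h.periodic_flux b c p t) x]

end IsC1Family

/-! ### Testing with Fourier modes -/

lemma integral_mul_deriv_periodic {f f' g g' : ℝ → ℝ} (hf : ∀ x, HasDerivAt f (f' x) x)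
    (hg : ∀ x, HasDerivAt g (g' x) x) (hf' : Continuous f') (hg' : Continuous g')
    (hfp : Function.Periodic f 1) (hgp : Function.Periodic g 1) :
    ∫ x in (0 : ℝ)..1, f x * g' x = -∫ x in (0 : ℝ)..1, f' x * g x := by
  have := intervalIntegral.integral_mul_deriv_eq_deriv_mul (a := 0) (b := 1)
    (fun x _ => hf x) (fun x _ => hg x) (hf'.intervalIntegrable _ _) (hg'.intervalIntegrable _ _)
  have e1 : f 1 = f 0 := by simpa using hfp 0
  have e2 : g 1 = g 0 := by simpa using hgp 0
  rw [this, e1, e2]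
  ring

lemma integral_swap_of_continuous {f : ℝ → ℝ → ℝ} (hf : Continuous (Function.uncurry f))
    (a b a' b' : ℝ) :
    ∫ t in a..b, ∫ x in a'..b', f t x = ∫ x in a'..b', ∫ t in a..b, f t x := by
  refine intervalIntegral_intervalIntegral_swap ?_
  have : IntegrableOn (Function.uncurry f) (uIcc a b ×ˢ uIcc a' b') (volume.prod volume) :=
    hf.continuousOn.integrableOn_compact (isCompact_uIcc.prod isCompact_uIcc)
  exact this.mono_set (prod_mono uIoc_subset_uIcc uIoc_subset_uIcc)

/-- An eigenfunction of `-∂ₓ²` on the circle. -/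
structure IsEigenfunction (κ : ℝ) (ψ ψ' : ℝ → ℝ) : Prop where
  smooth : ContDiff ℝ ∞ ψ
  periodic : Function.Periodic ψ 1
  deriv_one : ∀ x, HasDerivAt ψ (ψ' x) x
  deriv_two : ∀ x, HasDerivAt ψ' (-κ * ψ x) x

lemma IsEigenfunction.iteratedDeriv_two {κ : ℝ} {ψ ψ' : ℝ → ℝ} (h : IsEigenfunction κ ψ ψ')
    (x : ℝ) : iteratedDeriv 2 ψ x = -κ * ψ x := by
  rw [iteratedDeriv_succ, iteratedDeriv_one, show deriv ψ = ψ' from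
    funext fun x => (h.deriv_one x).deriv, (h.deriv_two x).deriv]

lemma IsEigenfunction.continuous_deriv {κ : ℝ} {ψ ψ' : ℝ → ℝ} (h : IsEigenfunction κ ψ ψ') :
    Continuous ψ' :=
  continuous_iff_continuousAt.mpr fun x => (h.deriv_two x).continuousAt

/-- The spatial terms of the weak equation, tested with an eigenfunction, in nonlocal form. -/
lemma integral_weak_terms {v w : ℝ → ℝ → ℝ} (hvw : IsC1Family v w) (b c : ℝ) {p : ℕ} (hp : 0 < p)
    {κ : ℝ} {ψ ψ' : ℝ → ℝ} (hψ : IsEigenfunction κ ψ ψ') (t : ℝ) :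
    ∫ x in (0 : ℝ)..1, ((b + c) * v t x ^ p * w t x * ψ x
        + (b - 3 * p * c) / 2 * (v t x ^ (p - 1) * w t x ^ 2) * ψ' x
        + c * (v t x ^ p * w t x) * (κ * ψ x)) =
      (1 + κ) * ∫ x in (0 : ℝ)..1, drift b c p v w t x * ψ x := by
  obtain ⟨M, hM⟩ := hvw.exists_flux_bound b c hp
  have cv := hvw.continuous_left t
  have cw := hvw.continuous_deriv_left t
  have cψ := hψ.smooth.continuous
  have cψ' := hψ.continuous_deriv
  set F : ℝ → ℝ := fun y => flux b c p (v t y) (w t y) with hF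
  have cF : Continuous F := hvw.continuous_flux_left b c p t
  have pF : Function.Periodic F 1 := hvw.periodic_flux b c p t
  have dg := hasDerivAt_resolvent cF (hM t)
  have dg' := hasDerivAt_resolventDeriv cF (hM t)
  have cg : Continuous (resolvent F) :=
    continuous_iff_continuousAt.mpr fun x => (dg x).continuousAt
  have cg' : Continuous (resolventDeriv F) :=
    continuous_iff_continuousAt.mpr fun x => (dg' x).continuousAt
  have e1 := integral_mul_deriv_periodic (f := fun x => v t x ^ (p + 1)) (g := ψ)
    (fun x => (hvw.hasDerivAt t x).pow (p + 1)) hψ.deriv_one (by fun_prop) cψ'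
    (fun x => by simp [hvw.periodic t x]) hψ.periodic
  have e2 := integral_mul_deriv_periodic dg hψ.deriv_one cg' cψ' (periodic_resolvent pF)
    hψ.periodic
  have e3 := integral_mul_deriv_periodic dg' hψ.deriv_two (cg.sub cF) (by fun_prop)
    (periodic_resolventDeriv pF) (hasDerivAt_periodic hψ.deriv_one hψ.periodic)
  have ci : ∀ {f : ℝ → ℝ}, Continuous f → IntervalIntegrable f volume 0 1 :=
    fun h => h.intervalIntegrable _ _
  have p1 : ((p : ℝ) + 1) ≠ 0 := by positivity
  have e1' : ∫ x in (0 : ℝ)..1, (v t x ^ (p + 1) * ψ' x + (p + 1) * (v t x ^ p * w t x * ψ x)) =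
      0 := by
    rw [intervalIntegral.integral_add (ci (by fun_prop)) (ci (by fun_prop)), e1,
      ← intervalIntegral.integral_neg, ← intervalIntegral.integral_add (ci (by fun_prop))
      (ci (by fun_prop))]
    refine (intervalIntegral.integral_congr fun x _ => ?_).trans intervalIntegral.integral_zero
    simp only [Nat.add_sub_cancel]
    push_cast
    ring
  have e2' : ∫ x in (0 : ℝ)..1, (resolvent F x * ψ' x + resolventDeriv F x * ψ x) = 0 := by
    rw [intervalIntegral.integral_add (ci (by fun_prop)) (ci (by fun_prop)), e2]
    ring
  have e3' : ∫ x in (0 : ℝ)..1, (resolventDeriv F x * (-κ * ψ x) +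
      (resolvent F x - F x) * ψ' x) = 0 := by
    rw [intervalIntegral.integral_add (ci (by fun_prop)) (ci (by fun_prop)), e3]
    ring
  -- With `g = resolvent F`, the last two identities give `(1 + κ) ∫ g' ψ = -∫ F ψ'`; the first
  -- converts the `v^{p+1}` part of `F ψ'` into the term `b v^p w ψ` of the weak equation.
  have rhs : ∫ x in (0 : ℝ)..1, ((b / (p + 1)) * (v t x ^ (p + 1) * ψ' x +
          (p + 1) * (v t x ^ p * w t x * ψ x))
        - (resolvent F x * ψ' x + resolventDeriv F x * ψ x)
        + (resolventDeriv F x * (-κ * ψ x) + (resolvent F x - F x) * ψ' x)) = 0 := by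
    rw [intervalIntegral.integral_add (ci (by fun_prop)) (ci (by fun_prop)),
      intervalIntegral.integral_sub (ci (by fun_prop)) (ci (by fun_prop)),
      intervalIntegral.integral_const_mul, e1', e2', e3']
    ring
  have key : ∫ x in (0 : ℝ)..1, ((b + c) * v t x ^ p * w t x * ψ x
        + (b - 3 * p * c) / 2 * (v t x ^ (p - 1) * w t x ^ 2) * ψ' x
        + c * (v t x ^ p * w t x) * (κ * ψ x)
        - (1 + κ) * (drift b c p v w t x * ψ x)) =
      0 := by
    refine (intervalIntegral.integral_congr fun x _ => ?_).trans rhs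
    have hFx : F x = b / (p + 1) * v t x ^ (p + 1) +
      (3 * p * c - b) / 2 * (v t x ^ (p - 1) * w t x ^ 2) := rfl
    have hdx : drift b c p v w t x = c * (v t x ^ p * w t x) + resolventDeriv F x := rfl
    have hb : b / (p + 1) * ((p : ℝ) + 1) = b := by field_simp
    simp only [hFx, hdx]
    linear_combination (-(v t x ^ p * w t x * ψ x)) * hb
  have cd : Continuous fun x => drift b c p v w t x :=
    (hvw.continuous_drift b c hp).comp (f := fun x => (t, x)) (by fun_prop)
  rw [intervalIntegral.integral_sub (ci (by fun_prop)) (ci (by fun_prop)),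
    intervalIntegral.integral_const_mul] at key
  linarith

lemma isEigenfunction_cos (k : ℤ) :
    IsEigenfunction ((2 * Real.pi * k) ^ 2) (fun x => Real.cos (2 * Real.pi * k * x))
      (fun x => -(2 * Real.pi * k * Real.sin (2 * Real.pi * k * x))) where
  smooth := by fun_prop
  periodic x := by
    simp only
    rw [← Real.cos_add_int_mul_two_pi (2 * Real.pi * k * x) k]
    congr 1
    ring
  deriv_one x := by
    have h : HasDerivAt (fun x => 2 * Real.pi * k * x) (2 * Real.pi * k) x := by
      simpa using (hasDerivAt_id x).const_mul (2 * Real.pi * k)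
    convert! h.cos using 1
    ring
  deriv_two x := by
    have h : HasDerivAt (fun x => 2 * Real.pi * k * x) (2 * Real.pi * k) x := by
      simpa using (hasDerivAt_id x).const_mul (2 * Real.pi * k)
    convert! (h.sin.const_mul (2 * Real.pi * k)).neg using 1
    ring

lemma isEigenfunction_sin (k : ℤ) :
    IsEigenfunction ((2 * Real.pi * k) ^ 2) (fun x => Real.sin (2 * Real.pi * k * x))
      (fun x => 2 * Real.pi * k * Real.cos (2 * Real.pi * k * x)) where
  smooth := by fun_prop
  periodic x := by
    simp only
    rw [← Real.sin_add_int_mul_two_pi (2 * Real.pi * k * x) k]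
    congr 1
    ring
  deriv_one x := by
    have h : HasDerivAt (fun x => 2 * Real.pi * k * x) (2 * Real.pi * k) x := by
      simpa using (hasDerivAt_id x).const_mul (2 * Real.pi * k)
    convert! h.sin using 1
    ring
  deriv_two x := by
    have h : HasDerivAt (fun x => 2 * Real.pi * k * x) (2 * Real.pi * k) x := by
      simpa using (hasDerivAt_id x).const_mul (2 * Real.pi * k)
    convert! h.cos.const_mul (2 * Real.pi * k) using 1
    ring

/-- A continuous periodic function orthogonal to all eigenfunctions of `-∂ₓ²` is zero. -/
lemma eq_zero_of_integral_eigenfunction {f : ℝ → ℝ} (hp : Function.Periodic f 1)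
    (hf : Continuous f) (h : ∀ κ ψ ψ', 0 ≤ κ → IsEigenfunction κ ψ ψ' →
      ∫ x in (0 : ℝ)..1, f x * ψ x = 0) (x : ℝ) : f x = 0 := by
  refine eq_zero_of_coeff_eq_zero hp hf (fun k => ?_) x
  have h1 := h _ _ _ (sq_nonneg _) (isEigenfunction_cos k)
  have h2 := h _ _ _ (sq_nonneg _) (isEigenfunction_sin k)
  have h1' : ∫ x in (0 : ℝ)..1, ((f x * Real.cos (2 * Real.pi * k * x) : ℝ) : ℂ) = 0 := by
    rw [intervalIntegral.integral_ofReal, h1, Complex.ofReal_zero]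
  have h2' : ∫ x in (0 : ℝ)..1, ((f x * Real.sin (2 * Real.pi * k * x) : ℝ) : ℂ) = 0 := by
    rw [intervalIntegral.integral_ofReal, h2, Complex.ofReal_zero]
  have e : ∀ x : ℝ, Complex.exp (-(2 * Real.pi * Complex.I * k * x)) * f x =
      ((f x * Real.cos (2 * Real.pi * k * x) : ℝ) : ℂ) -
        Complex.I * ((f x * Real.sin (2 * Real.pi * k * x) : ℝ) : ℂ) := fun x => by
    have : (-(2 * Real.pi * Complex.I * k * x) : ℂ) =
        ((-(2 * Real.pi * k * x) : ℝ) : ℂ) * Complex.I := by push_cast; ring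
    rw [this, Complex.exp_mul_I, ← Complex.ofReal_cos, ← Complex.ofReal_sin, Real.cos_neg,
      Real.sin_neg]
    push_cast
    ring
  rw [coeff_eq_integral]
  simp only [e]
  rw [intervalIntegral.integral_sub (Continuous.intervalIntegrable (by fun_prop) _ _)
    (Continuous.intervalIntegrable (by fun_prop) _ _), intervalIntegral.integral_const_mul, h1',
    h2']
  simp

/-- The nearest point of `[0, T₁]`. -/
def clampTime (T₁ t : ℝ) : ℝ := max 0 (min T₁ t)

lemma continuous_clampTime (T₁ : ℝ) : Continuous (clampTime T₁) := by
  unfold clampTime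
  fun_prop

lemma clampTime_mem {T₁ : ℝ} (h : 0 ≤ T₁) (t : ℝ) : clampTime T₁ t ∈ Icc 0 T₁ :=
  ⟨le_max_left _ _, max_le h (min_le_left _ _)⟩

lemma clampTime_of_mem {T₁ t : ℝ} (h : t ∈ Icc 0 T₁) : clampTime T₁ t = t := by
  rw [clampTime, min_eq_right h.2, max_eq_right h.1]

/-- Freezing the solution outside `[0, T₁]` gives functions continuous on the whole plane, so no
later continuity argument has to restrict the time variable. -/
lemma continuous_iteratedDeriv_clamp {s T T₁ : ℝ} {u : ℝ → ℝ → ℝ}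
    (hu : ContinuousInSobolev s T u) (hT₁ : 0 ≤ T₁) (hT : T₁ < T) {n : ℕ} (hs : n + 1 / 2 < s) :
    Continuous (Function.uncurry fun t => iteratedDeriv n (u (clampTime T₁ t))) := by
  have h := hu.continuousOn_iteratedDeriv hs
  have h2 : Continuous (fun z : ℝ × ℝ => (clampTime T₁ z.1, z.2)) :=
    ((continuous_clampTime T₁).comp continuous_fst).prodMk continuous_snd
  refine h.comp_continuous h2 fun z => ⟨?_, mem_univ _⟩
  have := clampTime_mem hT₁ z.1
  exact ⟨this.1, this.2.trans_lt hT⟩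

lemma exists_bound_clamp {s T T₁ : ℝ} {u : ℝ → ℝ → ℝ}
    (hu : ContinuousInSobolev s T u) (hT₁ : 0 ≤ T₁) (hT : T₁ < T) {n : ℕ} (hs : n + 1 / 2 < s) :
    ∃ M, ∀ t x, |iteratedDeriv n (u (clampTime T₁ t)) x| ≤ M := by
  obtain ⟨M, hM⟩ := (isCompact_Icc.prod isCompact_Icc).exists_bound_of_continuousOn
    (s := Icc (0 : ℝ) T₁ ×ˢ Icc (0 : ℝ) 1)
    (continuous_iteratedDeriv_clamp hu hT₁ hT hs).continuousOn
  refine ⟨M, fun t x => ?_⟩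
  have hper : Function.Periodic (iteratedDeriv n (u (clampTime T₁ t))) 1 := fun x => by
    have hp := (hu.mem (clampTime T₁ t)
      ⟨(clampTime_mem hT₁ t).1, (clampTime_mem hT₁ t).2.trans_lt hT⟩).1
    have := iteratedDeriv_comp_add_const n (u (clampTime T₁ t)) 1
    rw [show (fun z => u (clampTime T₁ t) (z + 1)) = u (clampTime T₁ t) from funext hp] at this
    exact (congrFun this x).symm
  obtain ⟨y, hy, hxy⟩ := hper.exists_mem_Ico₀ one_pos x
  have h1 := hM (clampTime T₁ t, y) ⟨clampTime_mem hT₁ t, Ico_subset_Icc_self hy⟩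
  simp only [Function.uncurry_apply_pair, clampTime_of_mem (clampTime_mem hT₁ t)] at h1
  rwa [hxy]

lemma isC1Family_clamp {s T T₁ : ℝ} {u : ℝ → ℝ → ℝ} (hs : 3 / 2 < s)
    (hu : ContinuousInSobolev s T u) (hT₁ : 0 ≤ T₁) (hT : T₁ < T) :
    IsC1Family (fun t => u (clampTime T₁ t)) (fun t => deriv (u (clampTime T₁ t))) := by
  have hmem : ∀ t, clampTime T₁ t ∈ Ico 0 T := fun t =>
    ⟨(clampTime_mem hT₁ t).1, (clampTime_mem hT₁ t).2.trans_lt hT⟩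
  have s0 : ((0 : ℕ) : ℝ) + 1 / 2 < s := by push_cast; linarith
  have s1 : ((1 : ℕ) : ℝ) + 1 / 2 < s := by push_cast; linarith
  refine ⟨?_, ?_, fun t x => ?_, fun t => (hu.mem _ (hmem t)).1, ?_⟩
  · simpa only [iteratedDeriv_zero] using continuous_iteratedDeriv_clamp hu hT₁ hT s0
  · simpa only [iteratedDeriv_one] using continuous_iteratedDeriv_clamp hu hT₁ hT s1
  · have := hasDerivAt_iteratedDeriv_of_memSobolev (hu.mem _ (hmem t))
      (hu.continuous_rep _ (hmem t)) (n := 0) s1 x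
    simpa only [iteratedDeriv_zero, zero_add, iteratedDeriv_one] using this
  · obtain ⟨M, hM⟩ := exists_bound_clamp hu hT₁ hT s0
    obtain ⟨M', hM'⟩ := exists_bound_clamp hu hT₁ hT s1
    simp only [iteratedDeriv_zero, iteratedDeriv_one] at hM hM'
    exact ⟨max M M', fun t x => ⟨(hM t x).trans (le_max_left _ _),
      (hM' t x).trans (le_max_right _ _)⟩⟩

/-- Solutions on `[0, T₁]` of the nonlocal form of the equation, integrated in time. -/
structure IsEvolution (b c : ℝ) (p : ℕ) (T₁ : ℝ) (v w : ℝ → ℝ → ℝ) : Prop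
    extends IsC1Family v w where
  evolves : ∀ t₀ ∈ Icc 0 T₁, ∀ t ∈ Icc 0 T₁, ∀ x,
    v t x - v t₀ x = -∫ τ in t₀..t, drift b c p v w τ x

/-- The weak equation tested with a product of a function of time and an eigenfunction. -/
lemma weak_eigenfunction {b c s T T₁ : ℝ} {p : ℕ} (hp : 0 < p) (hs : 3 / 2 < s) {u : ℝ → ℝ → ℝ}
    (hu : ContinuousInSobolev s T u) (hsol : SolvesWeakly b c p T u)
    (hbc : ((p : ℝ) - 1) * (b - p * c) = 0) (hT₁ : 0 ≤ T₁) (hT : T₁ < T)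
    {κ : ℝ} {ψ ψ' : ℝ → ℝ} (hψ : IsEigenfunction κ ψ ψ') {χ : ℝ → ℝ} (hχ : ContDiff ℝ ∞ χ)
    (hsupp : ∃ a' b', 0 < a' ∧ b' < T₁ ∧ ∀ t, t ∉ Icc a' b' → χ t = 0) :
    ∫ t in (0 : ℝ)..T₁,
      (-((1 + κ) * ∫ x in (0 : ℝ)..1, u (clampTime T₁ t) x * ψ x) * deriv χ t +
        ((1 + κ) * ∫ x in (0 : ℝ)..1, drift b c p (fun t => u (clampTime T₁ t))
          (fun t => deriv (u (clampTime T₁ t))) t x * ψ x) * χ t) = 0 := by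
  obtain ⟨a', b', ha', hb', h0⟩ := hsupp
  have hvw := isC1Family_clamp hs hu hT₁ hT
  have htest : IsTestFunction T (fun t x => χ t * ψ x) := by
    refine ⟨?_, fun t x => by simp only [hψ.periodic x], a', b', ha', hb'.trans hT,
      fun t ht x => by simp only [h0 t ht, zero_mul]⟩
    exact (hχ.comp contDiff_fst).mul (hψ.smooth.comp contDiff_snd)
  have key := hsol _ htest
  -- The weak equation integrates up to `T`, but the clamped solution agrees with `u` only up to
  -- `T₁`; beyond `T₁` the test function contributes nothing.
  have hdχ : ∀ t, T₁ ≤ t → deriv χ t = 0 := fun t ht => by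
    have : χ =ᶠ[𝓝 t] fun _ => 0 := by
      filter_upwards [Ioi_mem_nhds (hb'.trans_le ht)] with r hr
      exact h0 r fun h' => absurd h'.2 (not_le.mpr hr)
    rw [this.deriv_eq, deriv_const]
  have hχ0 : ∀ t, T₁ ≤ t → χ t = 0 := fun t ht =>
    h0 t fun h' => by linarith [h'.2]
  have hd1 : ∀ t x, deriv (fun τ => χ τ * ψ x) t = deriv χ t * ψ x := fun t x =>
    deriv_mul_const (hχ.differentiable (by simp) t) _
  have hd2 : ∀ (r x : ℝ), iteratedDeriv 2 (fun y => r * ψ y) x = r * (-κ * ψ x) := fun r x => by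
    rw [iteratedDeriv_const_mul_field, hψ.iteratedDeriv_two]
  have hd3 : ∀ (r x : ℝ), deriv (fun y => r * ψ y) x = r * ψ' x := fun r x =>
    ((hψ.deriv_one x).const_mul r).deriv
  have hcub : ((p : ℝ) - 1) * (b - p * c) / 2 = 0 := by rw [hbc, zero_div]
  simp only [hd1, hd2, hd3, hcub, zero_mul, add_zero] at key
  set G : ℝ → ℝ := fun t => ∫ x in (0 : ℝ)..1,
    (- u t x * (deriv χ t * ψ x - deriv χ t * (-κ * ψ x))
        + (b + c) * u t x ^ p * deriv (u t) x * (χ t * ψ x)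
        + (b - 3 * p * c) / 2 * (u t x ^ (p - 1) * deriv (u t) x ^ 2) * (χ t * ψ' x)
        - c * (u t x ^ p * deriv (u t) x) * (χ t * (-κ * ψ x))) with hG
  change ∫ t in (0 : ℝ)..T, G t = 0 at key
  have hGin : ∀ t ∈ Icc 0 T₁, G t =
      -((1 + κ) * ∫ x in (0 : ℝ)..1, u (clampTime T₁ t) x * ψ x) * deriv χ t +
        ((1 + κ) * ∫ x in (0 : ℝ)..1, drift b c p (fun t => u (clampTime T₁ t))
          (fun t => deriv (u (clampTime T₁ t))) t x * ψ x) * χ t := fun t ht => by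
    have e := integral_weak_terms hvw b c hp hψ t
    have cv := hvw.continuous_left t
    have cw := hvw.continuous_deriv_left t
    have cψ := hψ.smooth.continuous
    have cψ' := hψ.continuous_deriv
    have ci : ∀ {f : ℝ → ℝ}, Continuous f → IntervalIntegrable f volume 0 1 :=
      fun h => h.intervalIntegrable _ _
    rw [← e]
    simp only [clampTime_of_mem ht] at cv cw ⊢
    rw [← intervalIntegral.integral_const_mul, ← intervalIntegral.integral_neg,
      ← intervalIntegral.integral_mul_const, ← intervalIntegral.integral_mul_const,
      ← intervalIntegral.integral_add (ci (by fun_prop)) (ci (by fun_prop))]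
    refine intervalIntegral.integral_congr fun x _ => ?_
    ring
  have hGout : ∀ t, T₁ ≤ t → G t = 0 := fun t ht => by
    simp only [hG, hdχ t ht, hχ0 t ht, zero_mul, mul_zero, sub_zero, add_zero,
      intervalIntegral.integral_zero]
  have e1 : ∫ t in T₁..T, G t = 0 := by
    refine (intervalIntegral.integral_congr fun t ht => ?_).trans intervalIntegral.integral_zero
    rw [uIcc_of_le hT.le] at ht
    exact hGout t ht.1
  have hcont : Continuous fun t =>
      -((1 + κ) * ∫ x in (0 : ℝ)..1, u (clampTime T₁ t) x * ψ x) * deriv χ t +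
        ((1 + κ) * ∫ x in (0 : ℝ)..1, drift b c p (fun t => u (clampTime T₁ t))
          (fun t => deriv (u (clampTime T₁ t))) t x * ψ x) * χ t := by
    have cψ := hψ.smooth.continuous
    have cχ := hχ.continuous
    have cχ' : Continuous (deriv χ) := hχ.continuous_deriv (by simp)
    have c1 : Continuous fun t => ∫ x in (0 : ℝ)..1, u (clampTime T₁ t) x * ψ x :=
      intervalIntegral.continuous_parametric_intervalIntegral_of_continuous'
        (f := fun t x => u (clampTime T₁ t) x * ψ x)
        (hvw.cont.mul (cψ.comp continuous_snd)) 0 1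
    have c2 : Continuous fun t => ∫ x in (0 : ℝ)..1, drift b c p (fun t => u (clampTime T₁ t))
          (fun t => deriv (u (clampTime T₁ t))) t x * ψ x :=
      intervalIntegral.continuous_parametric_intervalIntegral_of_continuous'
        (f := fun t x => drift b c p (fun t => u (clampTime T₁ t))
          (fun t => deriv (u (clampTime T₁ t))) t x * ψ x)
        ((hvw.continuous_drift b c hp).mul (cψ.comp continuous_snd)) 0 1
    fun_prop
  have i1 : IntervalIntegrable G volume 0 T₁ := by
    refine (hcont.intervalIntegrable 0 T₁).congr fun t ht => ?_
    rw [uIoc_of_le hT₁] at ht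
    exact (hGin t (Ioc_subset_Icc_self ht)).symm
  have i2 : IntervalIntegrable G volume T₁ T := by
    refine (continuous_const (y := (0 : ℝ)).intervalIntegrable T₁ T).congr fun t ht => ?_
    rw [uIoc_of_le hT.le] at ht
    exact (hGout t ht.1.le).symm
  rw [← intervalIntegral.integral_add_adjacent_intervals i1 i2, e1, add_zero] at key
  refine (intervalIntegral.integral_congr fun t ht => ?_).trans key
  rw [uIcc_of_le hT₁] at ht
  exact (hGin t ht).symm

/-- A weak solution solves the nonlocal form of the equation. -/
lemma isEvolution_clamp {b c s T T₁ : ℝ} {p : ℕ} (hp : 0 < p) (hs : 3 / 2 < s) {u : ℝ → ℝ → ℝ}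
    (hu : ContinuousInSobolev s T u) (hsol : SolvesWeakly b c p T u)
    (hbc : ((p : ℝ) - 1) * (b - p * c) = 0) (hT₁ : 0 < T₁) (hT : T₁ < T) :
    IsEvolution b c p T₁ (fun t => u (clampTime T₁ t)) (fun t => deriv (u (clampTime T₁ t))) := by
  have hvw := isC1Family_clamp hs hu hT₁.le hT
  refine ⟨hvw, fun t₀ ht₀ t ht x => ?_⟩
  set v : ℝ → ℝ → ℝ := fun t => u (clampTime T₁ t) with hv
  set w : ℝ → ℝ → ℝ := fun t => deriv (u (clampTime T₁ t)) with hw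
  have cd := hvw.continuous_drift b c hp
  have cswap : Continuous (Function.uncurry fun x τ => drift b c p v w τ x) :=
    cd.comp (f := fun z : ℝ × ℝ => (z.2, z.1)) (by fun_prop)
  have cI : Continuous fun x => ∫ τ in t₀..t, drift b c p v w τ x :=
    intervalIntegral.continuous_parametric_intervalIntegral_of_continuous' cswap t₀ t
  have cv := hvw.continuous_left t
  have cv₀ := hvw.continuous_left t₀
  have hz := eq_zero_of_integral_eigenfunction
    (f := fun x => v t x - v t₀ x + ∫ τ in t₀..t, drift b c p v w τ x)
    (fun x => by
      simp only [hvw.periodic t x, hvw.periodic t₀ x, hvw.periodic_drift b c p _ x])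
    (by fun_prop)
    (fun κ ψ ψ' hκ hψ => by
      have cψ := hψ.smooth.continuous
      have c1 : Continuous fun t => ∫ x in (0 : ℝ)..1, v t x * ψ x :=
        intervalIntegral.continuous_parametric_intervalIntegral_of_continuous'
          (f := fun t x => v t x * ψ x) (hvw.cont.mul (cψ.comp continuous_snd)) 0 1
      have cdψ : Continuous (Function.uncurry fun t x => drift b c p v w t x * ψ x) :=
        cd.mul (cψ.comp continuous_snd)
      have c2 : Continuous fun t => ∫ x in (0 : ℝ)..1, drift b c p v w t x * ψ x :=
        intervalIntegral.continuous_parametric_intervalIntegral_of_continuous' cdψ 0 1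
      have e := sub_eq_neg_integral_of_weak (c1.const_mul (1 + κ)) (c2.const_mul (1 + κ)) hT₁
        (fun χ hχ hsupp => weak_eigenfunction hp hs hu hsol hbc hT₁.le hT hψ hχ hsupp) ht₀ ht
      rw [intervalIntegral.integral_const_mul, integral_swap_of_continuous cdψ] at e
      -- On a mode with eigenvalue `κ ≥ 0` the operator `1 - ∂ₓ²` is multiplication by `1 + κ`, and
      -- this is the point where it is inverted.
      have hκ' : (1 + κ) ≠ 0 := by positivity
      have e' : (∫ x in (0 : ℝ)..1, v t x * ψ x) - (∫ x in (0 : ℝ)..1, v t₀ x * ψ x) +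
          ∫ x in (0 : ℝ)..1, ∫ τ in t₀..t, drift b c p v w τ x * ψ x = 0 := by
        apply mul_left_cancel₀ hκ'
        linear_combination e
      simp only [intervalIntegral.integral_mul_const] at e'
      have ci : ∀ {f : ℝ → ℝ}, Continuous f → IntervalIntegrable f volume 0 1 :=
        fun h => h.intervalIntegrable _ _
      rw [← intervalIntegral.integral_sub (ci (by fun_prop)) (ci (by fun_prop)),
        ← intervalIntegral.integral_add (ci (by fun_prop)) (ci (by fun_prop))] at e'
      refine (intervalIntegral.integral_congr fun x _ => ?_).trans e'
      ring) x
  linarith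

namespace IsEvolution

variable {b c T₁ : ℝ} {p : ℕ} {v w : ℝ → ℝ → ℝ}

lemma hasDerivAt_time (h : IsEvolution b c p T₁ v w) (hp : 0 < p) {t : ℝ} (ht : t ∈ Ioo 0 T₁)
    (x : ℝ) : HasDerivAt (fun t => v t x) (-drift b c p v w t x) t := by
  have cd : Continuous fun τ => drift b c p v w τ x :=
    (h.continuous_drift b c hp).comp (f := fun τ => (τ, x)) (by fun_prop)
  have h1 : HasDerivAt (fun t => v 0 x + -∫ τ in (0 : ℝ)..t, drift b c p v w τ x)
      (-drift b c p v w t x) t :=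
    ((cd.integral_hasStrictDerivAt 0 t).hasDerivAt.neg).const_add _
  refine h1.congr_of_eventuallyEq ?_
  filter_upwards [Ioo_mem_nhds ht.1 ht.2] with r hr
  have := h.evolves 0 ⟨le_rfl, (hr.1.trans hr.2).le⟩ r (Ioo_subset_Icc_self hr) x
  linarith

end IsEvolution

/-! ### Characteristics -/

lemma abs_sub_le_of_abs_deriv_le {f f' : ℝ → ℝ} {L : ℝ} (hf : ∀ x, HasDerivAt f (f' x) x)
    (hL : ∀ x, |f' x| ≤ L) (x y : ℝ) : |f x - f y| ≤ L * |x - y| :=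
  convex_univ.norm_image_sub_le_of_norm_hasDerivWithin_le
    (fun x _ => (hf x).hasDerivWithinAt) (fun x _ => hL x) (mem_univ y) (mem_univ x)

/-- Integral curves on `[0, T₁]` of a time-dependent vector field on the line. -/
def IsIntegralCurve (T₁ : ℝ) (a : ℝ → ℝ → ℝ) (q : ℝ → ℝ) : Prop :=
  ∀ t ∈ Icc 0 T₁, HasDerivWithinAt q (a t (q t)) (Icc 0 T₁) t

/-- The bound `L` on the speed is global, so a ball of radius `L` times the available time cannot be
left, and Picard-Lindelöf covers all of `[0, T₁]` at once. -/
lemma exists_integralCurve {T₁ : ℝ} {a : ℝ → ℝ → ℝ} (ha : Continuous (Function.uncurry a))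
    {K L : ℝ} (hL : ∀ t x, |a t x| ≤ L) (hK : ∀ t x y, |a t x - a t y| ≤ K * |x - y|)
    {t₀ : ℝ} (ht₀ : t₀ ∈ Icc 0 T₁) (x₀ : ℝ) :
    ∃ q, q t₀ = x₀ ∧ IsIntegralCurve T₁ a q := by
  have hL0 : 0 ≤ L := (abs_nonneg _).trans (hL 0 0)
  have hK0 : 0 ≤ K := by
    have := (abs_nonneg _).trans (hK 0 1 0)
    simpa using this
  have hR0 : 0 ≤ L * max (T₁ - t₀) (t₀ - 0) :=
    mul_nonneg hL0 (le_max_of_le_left (by linarith [ht₀.2]))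
  have hPL : IsPicardLindelof a (⟨t₀, ht₀⟩ : Icc 0 T₁) x₀
      ⟨L * max (T₁ - t₀) (t₀ - 0), hR0⟩ 0 ⟨L, hL0⟩ ⟨K, hK0⟩ := by
    refine ⟨fun t _ => LipschitzOnWith.of_dist_le_mul fun x _ y _ => hK t x y, fun x _ => ?_,
      fun t _ x _ => hL t x, ?_⟩
    · exact (ha.comp (f := fun t => (t, x)) (by fun_prop)).continuousOn
    · change L * max (T₁ - t₀) (t₀ - 0) ≤ L * max (T₁ - t₀) (t₀ - 0) - 0
      simp only [sub_zero, le_refl]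
  exact hPL.exists_eq_forall_mem_Icc_hasDerivWithinAt₀

namespace IsIntegralCurve

variable {T₁ K : ℝ} {a : ℝ → ℝ → ℝ} {q q₁ q₂ : ℝ → ℝ}

lemma continuousOn (h : IsIntegralCurve T₁ a q) : ContinuousOn q (Icc 0 T₁) :=
  fun t ht => (h t ht).continuousWithinAt

lemma hasDerivAt (h : IsIntegralCurve T₁ a q) {t : ℝ} (ht : t ∈ Ioo 0 T₁) :
    HasDerivAt q (a t (q t)) t :=
  (h t (Ioo_subset_Icc_self ht)).hasDerivAt (Icc_mem_nhds ht.1 ht.2)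

/-- The squared distance `d` satisfies `|d'| ≤ 2 K d`, hence `e^{-2Kr} d` decreases and `e^{2Kr} d`
increases. The two monotonicities serve the two orders of `s` and `t`; a square root halves the
exponent. -/
lemma abs_sub_le (h₁ : IsIntegralCurve T₁ a q₁) (h₂ : IsIntegralCurve T₁ a q₂) (hK0 : 0 ≤ K)
    (hK : ∀ t x y, |a t x - a t y| ≤ K * |x - y|) {s t : ℝ} (hs : s ∈ Icc 0 T₁)
    (ht : t ∈ Icc 0 T₁) : |q₁ s - q₂ s| ≤ Real.exp (K * T₁) * |q₁ t - q₂ t| := by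
  set d : ℝ → ℝ := fun r => (q₁ r - q₂ r) ^ 2 with hd
  have hdc : ContinuousOn d (Icc 0 T₁) := (h₁.continuousOn.sub h₂.continuousOn).pow 2
  set d' : ℝ → ℝ := fun r => 2 * (q₁ r - q₂ r) * (a r (q₁ r) - a r (q₂ r)) with hd'
  have hdd : ∀ r ∈ Ioo 0 T₁, HasDerivAt d (d' r) r := fun r hr => by
    convert! ((h₁.hasDerivAt hr).sub (h₂.hasDerivAt hr)).pow 2 using 1
    simp [hd']
  have hb : ∀ r, |d' r| ≤ 2 * K * d r := fun r => by
    have := hK r (q₁ r) (q₂ r)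
    simp only [hd', hd]
    rw [abs_mul, abs_mul, abs_two, ← sq_abs (q₁ r - q₂ r)]
    nlinarith [mul_le_mul_of_nonneg_left this (abs_nonneg (q₁ r - q₂ r))]
  have hexp : ∀ C r : ℝ, HasDerivAt (fun r => Real.exp (C * r)) (Real.exp (C * r) * C) r :=
    fun C r => by
      have h : HasDerivAt (fun r => C * r) C r := by simpa using (hasDerivAt_id r).const_mul C
      exact h.exp
  have hanti : AntitoneOn (fun r => Real.exp (-(2 * K) * r) * d r) (Icc 0 T₁) := by
    have hD : ∀ r ∈ Ioo 0 T₁, HasDerivAt (fun r => Real.exp (-(2 * K) * r) * d r)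
        (Real.exp (-(2 * K) * r) * -(2 * K) * d r + Real.exp (-(2 * K) * r) * d' r) r :=
      fun r hr => (hexp _ r).mul (hdd r hr)
    refine antitoneOn_of_deriv_nonpos (convex_Icc _ _)
      ((by fun_prop : Continuous fun r : ℝ => Real.exp (-(2 * K) * r)).continuousOn.mul hdc)
      (fun r hr => ?_) (fun r hr => ?_)
    · rw [interior_Icc] at hr
      exact (hD r hr).differentiableAt.differentiableWithinAt
    · rw [interior_Icc] at hr
      rw [(hD r hr).deriv]
      have := (abs_le.mp (hb r)).2
      nlinarith [Real.exp_pos (-(2 * K) * r)]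
  have hmono : MonotoneOn (fun r => Real.exp (2 * K * r) * d r) (Icc 0 T₁) := by
    have hD : ∀ r ∈ Ioo 0 T₁, HasDerivAt (fun r => Real.exp (2 * K * r) * d r)
        (Real.exp (2 * K * r) * (2 * K) * d r + Real.exp (2 * K * r) * d' r) r :=
      fun r hr => (hexp _ r).mul (hdd r hr)
    refine monotoneOn_of_deriv_nonneg (convex_Icc _ _)
      ((by fun_prop : Continuous fun r : ℝ => Real.exp (2 * K * r)).continuousOn.mul hdc)
      (fun r hr => ?_) (fun r hr => ?_)
    · rw [interior_Icc] at hr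
      exact (hD r hr).differentiableAt.differentiableWithinAt
    · rw [interior_Icc] at hr
      rw [(hD r hr).deriv]
      have := (abs_le.mp (hb r)).1
      nlinarith [Real.exp_pos (2 * K * r)]
  have hdt : 0 ≤ d t := sq_nonneg _
  have main : d s ≤ Real.exp (2 * K * T₁) * d t := by
    rcases le_total t s with hts | hst
    · have h := hanti ht hs hts
      simp only at h
      have h2 : d s ≤ Real.exp (2 * K * s) * (Real.exp (-(2 * K) * t) * d t) := by
        have e : Real.exp (2 * K * s) * (Real.exp (-(2 * K) * s) * d s) = d s := by
          rw [← mul_assoc, ← Real.exp_add]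
          simp
        rw [← e]
        exact mul_le_mul_of_nonneg_left h (Real.exp_pos _).le
      refine h2.trans ?_
      rw [← mul_assoc, ← Real.exp_add]
      refine mul_le_mul_of_nonneg_right (Real.exp_le_exp.mpr ?_) hdt
      nlinarith [ht.1, hs.2, mul_nonneg hK0 ht.1, mul_nonneg hK0 (sub_nonneg.mpr hs.2)]
    · have h := hmono hs ht hst
      simp only at h
      have h2 : d s ≤ Real.exp (-(2 * K) * s) * (Real.exp (2 * K * t) * d t) := by
        have e : Real.exp (-(2 * K) * s) * (Real.exp (2 * K * s) * d s) = d s := by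
          rw [← mul_assoc, ← Real.exp_add]
          simp
        rw [← e]
        exact mul_le_mul_of_nonneg_left h (Real.exp_pos _).le
      refine h2.trans ?_
      rw [← mul_assoc, ← Real.exp_add]
      refine mul_le_mul_of_nonneg_right (Real.exp_le_exp.mpr ?_) hdt
      nlinarith [ht.1, hs.2, mul_nonneg hK0 hs.1, mul_nonneg hK0 (sub_nonneg.mpr ht.2)]
  refine abs_le_of_sq_le_sq' ?_ (by positivity) |> abs_le.mpr
  rw [mul_pow, sq_abs, ← Real.exp_nat_mul]
  convert! main using 3
  push_cast
  ring

/-- To change their order the curves would have to meet, and curves that meet once coincide. -/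
lemma le_of_lt (h₁ : IsIntegralCurve T₁ a q₁) (h₂ : IsIntegralCurve T₁ a q₂) (hK0 : 0 ≤ K)
    (hK : ∀ t x y, |a t x - a t y| ≤ K * |x - y|) {s t : ℝ} (hs : s ∈ Icc 0 T₁)
    (ht : t ∈ Icc 0 T₁) (hlt : q₁ t < q₂ t) : q₁ s ≤ q₂ s := by
  by_contra! hcon
  obtain ⟨r, hr, hr'⟩ := isPreconnected_Icc.intermediate_value₂ ht hs h₁.continuousOn
    h₂.continuousOn hlt.le hcon.le
  have := abs_sub_le h₁ h₂ hK0 hK ht hr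
  rw [hr', sub_self, abs_zero, mul_zero] at this
  have := abs_eq_zero.mp (le_antisymm this (abs_nonneg _))
  linarith

/-- Change of a function along an integral curve. -/
lemma sub_eq_integral (hq : IsIntegralCurve T₁ a q) (ha : Continuous (Function.uncurry a))
    {V W R : ℝ → ℝ → ℝ} (hV : Continuous (Function.uncurry V))
    (hW : Continuous (Function.uncurry W)) (hR : Continuous (Function.uncurry R))
    (hVx : ∀ t x, HasDerivAt (V t) (W t x) x)
    (hVt : ∀ t ∈ Ioo 0 T₁, ∀ x, HasDerivAt (fun t => V t x) (R t x) t)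
    {t₀ t : ℝ} (ht₀ : t₀ ∈ Icc 0 T₁) (ht : t ∈ Icc 0 T₁) :
    V t (q t) - V t₀ (q t₀) = ∫ τ in t₀..t, (R τ (q τ) + W τ (q τ) * a τ (q τ)) := by
  have hsub : uIcc t₀ t ⊆ Icc 0 T₁ := uIcc_subset_Icc ht₀ ht
  have hpair : ContinuousOn (fun τ => (τ, q τ)) (uIcc t₀ t) :=
    continuousOn_id.prodMk (hq.continuousOn.mono hsub)
  symm
  refine intervalIntegral.integral_eq_sub_of_hasDeriv_right (f := fun τ => V τ (q τ))
    (hV.comp_continuousOn hpair) (fun τ hτ => HasDerivAt.hasDerivWithinAt ?_) ?_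
  · have hτ' : τ ∈ Ioo 0 T₁ :=
      ⟨(le_min ht₀.1 ht.1).trans_lt hτ.1, hτ.2.trans_le (max_le ht₀.2 ht.2)⟩
    -- Continuous partial derivatives give joint differentiability, which the chain rule along the
    -- curve requires.
    have hF : HasStrictFDerivAt (Function.HasUncurry.uncurry V)
        ((ContinuousLinearMap.toSpanSingleton ℝ (R τ (q τ))).coprod
          (ContinuousLinearMap.toSpanSingleton ℝ (W τ (q τ)))) (τ, q τ) := by
      have cspan : Continuous fun r : ℝ => ContinuousLinearMap.toSpanSingleton ℝ r :=
        (ContinuousLinearMap.toSpanSingletonLIE ℝ ℝ).continuous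
      refine hasStrictFDerivAt_uncurry_coprod (u := (τ, q τ)) (f := V)
        (f₁ := fun t x => ContinuousLinearMap.toSpanSingleton ℝ (R t x))
        (f₂ := fun t x => ContinuousLinearMap.toSpanSingleton ℝ (W t x)) ?_ ?_ ?_ ?_
      · have : ∀ᶠ z : ℝ × ℝ in 𝓝 (τ, q τ), z.1 ∈ Ioo 0 T₁ :=
          continuous_fst.continuousAt.eventually (Ioo_mem_nhds hτ'.1 hτ'.2)
        filter_upwards [this] with z hz
        exact (hVt z.1 hz z.2).hasFDerivAt
      · exact Eventually.of_forall fun z => (hVx z.1 z.2).hasFDerivAt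
      · exact (cspan.comp hR).continuousAt
      · exact (cspan.comp hW).continuousAt
    have := hF.hasFDerivAt.comp_hasDerivAt τ ((hasDerivAt_id τ).prodMk (hq.hasDerivAt hτ'))
    convert! this using 1
    simp [mul_comm]
  · refine ContinuousOn.intervalIntegrable ?_
    exact (hR.comp_continuousOn hpair).add
      ((hW.comp_continuousOn hpair).mul (ha.comp_continuousOn hpair))

end IsIntegralCurve

/-! ### Propagation of zero -/

/-- The primitive `J` of `N` starts at zero and satisfies `|J'| ≤ C |J|`, so the differential form
of Grönwall's lemma applies to `J`. -/
lemma eq_zero_of_le_integral_right {N : ℝ → ℝ} (hN : Continuous N) (h0 : ∀ t, 0 ≤ N t)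
    {C t₀ t₁ : ℝ} (h : ∀ t ∈ Icc t₀ t₁, N t ≤ C * ∫ τ in t₀..t, N τ)
    {t : ℝ} (ht : t ∈ Icc t₀ t₁) : N t = 0 := by
  have hd : ∀ t, HasDerivAt (fun t => ∫ τ in t₀..t, N τ) (N t) t := fun t =>
    (hN.integral_hasStrictDerivAt t₀ t).hasDerivAt
  have hJ := eq_zero_of_abs_deriv_le_mul_abs_self_of_eq_zero_right (K := C)
    (f := fun t => ∫ τ in t₀..t, N τ) (f' := N) (a := t₀) (b := t₁)
    (fun t _ => (hd t).continuousAt.continuousWithinAt) (fun t _ => (hd t).hasDerivWithinAt)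
    (by simp) (fun t ht => by
      rw [Real.norm_of_nonneg (h0 t), Real.norm_of_nonneg
        (intervalIntegral.integral_nonneg ht.1 fun τ _ => h0 τ)]
      exact h t (Ico_subset_Icc_self ht))
  have := h t ht
  rw [hJ t ht, mul_zero] at this
  exact le_antisymm this (h0 t)

/-- A two-sided version of Grönwall's lemma with zero data. -/
lemma eq_zero_of_le_abs_integral {N : ℝ → ℝ} (hN : Continuous N) (h0 : ∀ t, 0 ≤ N t)
    {C T₁ t₀ : ℝ} (ht₀ : t₀ ∈ Icc 0 T₁) (h : ∀ t ∈ Icc 0 T₁, N t ≤ C * |∫ τ in t₀..t, N τ|)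
    {t : ℝ} (ht : t ∈ Icc 0 T₁) : N t = 0 := by
  rcases le_total t₀ t with htt | htt
  · refine eq_zero_of_le_integral_right hN h0 (C := C) (t₀ := t₀) (t₁ := T₁) (fun r hr => ?_)
      ⟨htt, ht.2⟩
    have := h r ⟨ht₀.1.trans hr.1, hr.2⟩
    rwa [abs_of_nonneg (intervalIntegral.integral_nonneg hr.1 fun τ _ => h0 τ)] at this
  -- Times before `t₀` are handled by reversing time.
  · have := eq_zero_of_le_integral_right (N := fun r => N (-r)) (by fun_prop) (fun r => h0 _)
      (C := C) (t₀ := -t₀) (t₁ := 0) (fun r hr => by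
        have h1 := h (-r) ⟨by linarith [hr.2], by linarith [hr.1, ht₀.2]⟩
        rw [intervalIntegral.integral_comp_neg (fun r => N r), neg_neg]
        rwa [intervalIntegral.integral_symm, abs_neg, abs_of_nonneg
          (intervalIntegral.integral_nonneg (by linarith [hr.1]) fun τ _ => h0 τ)] at h1)
      (t := -t) ⟨by linarith, by linarith [ht.1]⟩
    simpa using this

namespace IsC1Family

variable {v w : ℝ → ℝ → ℝ}

/-- The `C¹` norm of `v t`. -/
def c1Norm (v w : ℝ → ℝ → ℝ) (t : ℝ) : ℝ :=
  sSup ((fun x => max |v t x| |w t x|) '' Icc (0 : ℝ) 1)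

lemma continuous_c1Norm (h : IsC1Family v w) : Continuous (c1Norm v w) := by
  have h1 := h.cont
  have h2 := h.cont_deriv
  refine isCompact_Icc.continuous_sSup (f := fun t x => max |v t x| |w t x|) ?_
  exact (continuous_abs.comp h1).max (continuous_abs.comp h2)

lemma le_c1Norm (h : IsC1Family v w) (t x : ℝ) : max |v t x| |w t x| ≤ c1Norm v w t := by
  obtain ⟨M, hM⟩ := h.bounded
  have hper : Function.Periodic (fun x => max |v t x| |w t x|) 1 := fun x => by
    simp only [h.periodic t x, h.periodic_deriv t x]
  obtain ⟨y, hy, hxy⟩ := hper.exists_mem_Ico₀ one_pos x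
  rw [hxy]
  refine le_csSup ⟨M, ?_⟩ ⟨y, Ico_subset_Icc_self hy, rfl⟩
  rintro _ ⟨z, -, rfl⟩
  exact max_le (hM t z).1 (hM t z).2

lemma c1Norm_nonneg (h : IsC1Family v w) (t : ℝ) : 0 ≤ c1Norm v w t :=
  ((abs_nonneg _).trans (le_max_left _ _)).trans (h.le_c1Norm t 0)

lemma c1Norm_le {C t : ℝ} (hC : ∀ x, max |v t x| |w t x| ≤ C) : c1Norm v w t ≤ C := by
  refine csSup_le ((nonempty_Icc.mpr zero_le_one).image _) ?_
  rintro _ ⟨x, -, rfl⟩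
  exact hC x

lemma continuous_speed (h : IsC1Family v w) (c : ℝ) (p : ℕ) :
    Continuous (Function.uncurry fun t x => c * v t x ^ p) :=
  continuous_const.mul (h.cont.pow p)

lemma exists_speed_bounds (h : IsC1Family v w) (c : ℝ) (p : ℕ) :
    ∃ K L, 0 ≤ K ∧ (∀ t x, |c * v t x ^ p| ≤ L) ∧
      ∀ t x y, |c * v t x ^ p - c * v t y ^ p| ≤ K * |x - y| := by
  obtain ⟨M, hM⟩ := h.bounded
  have hM0 : 0 ≤ M := (abs_nonneg _).trans (hM 0 0).1
  refine ⟨|c| * (p * M ^ (p - 1) * M), |c| * M ^ p, by positivity, fun t x => ?_, fun t => ?_⟩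
  · rw [abs_mul, abs_pow]
    exact mul_le_mul_of_nonneg_left (pow_le_pow_left₀ (abs_nonneg _) (hM t x).1 _) (abs_nonneg _)
  · refine abs_sub_le_of_abs_deriv_le (f := fun x => c * v t x ^ p)
      (fun x => ((h.hasDerivAt t x).pow p).const_mul c) fun x => ?_
    rw [abs_mul, abs_mul, abs_mul, abs_pow, Nat.abs_cast]
    refine mul_le_mul_of_nonneg_left ?_ (abs_nonneg _)
    refine mul_le_mul ?_ (hM t x).2 (abs_nonneg _) (by positivity)
    exact mul_le_mul_of_nonneg_left (pow_le_pow_left₀ (abs_nonneg _) (hM t x).1 _) (by positivity)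

end IsC1Family

namespace IsEvolution

variable {b c T₁ : ℝ} {p : ℕ} {v w : ℝ → ℝ → ℝ}

/-- Evolution along characteristics. -/
lemma sub_eq_neg_integral (h : IsEvolution b c p T₁ v w) (hp : 0 < p) {q : ℝ → ℝ}
    (hq : IsIntegralCurve T₁ (fun t x => c * v t x ^ p) q) {t₀ t : ℝ} (ht₀ : t₀ ∈ Icc 0 T₁)
    (ht : t ∈ Icc 0 T₁) :
    v t (q t) - v t₀ (q t₀) =
      -∫ τ in t₀..t, resolventDeriv (fun y => flux b c p (v τ y) (w τ y)) (q τ) := by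
  have hC1 := h.toIsC1Family
  rw [hq.sub_eq_integral (hC1.continuous_speed c p) hC1.cont hC1.cont_deriv
    (R := fun t x => -drift b c p v w t x) (hC1.continuous_drift b c hp).neg hC1.hasDerivAt
    (fun t ht x => h.hasDerivAt_time hp ht x) ht₀ ht, ← intervalIntegral.integral_neg]
  refine intervalIntegral.integral_congr fun τ _ => ?_
  simp only [drift]
  ring

lemma intervalIntegrable_resolventDeriv (h : IsEvolution b c p T₁ v w) (hp : 0 < p) {q : ℝ → ℝ}
    (hq : IsIntegralCurve T₁ (fun t x => c * v t x ^ p) q) {t₀ t : ℝ} (ht₀ : t₀ ∈ Icc 0 T₁)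
    (ht : t ∈ Icc 0 T₁) :
    IntervalIntegrable (fun τ => resolventDeriv (fun y => flux b c p (v τ y) (w τ y)) (q τ))
      volume t₀ t := by
  obtain ⟨M, hM⟩ := h.exists_flux_bound b c hp
  have crd := continuous_uncurry_resolventDeriv (h.continuous_flux b c p) hM
  exact (crd.comp_continuousOn (f := fun τ => (τ, q τ)) (continuousOn_id.prodMk
    (hq.continuousOn.mono (uIcc_subset_Icc ht₀ ht)))).intervalIntegrable

open IsC1Family in
/-- A solution that vanishes at one time vanishes at all times. -/
lemma eq_zero_of_eq_zero (h : IsEvolution b c p T₁ v w) (hp : 0 < p) {t₀ : ℝ}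
    (ht₀ : t₀ ∈ Icc 0 T₁)
    (h0 : ∀ x, v t₀ x = 0) {t : ℝ} (ht : t ∈ Icc 0 T₁) (x : ℝ) : v t x = 0 := by
  have hC1 := h.toIsC1Family
  obtain ⟨M, hM⟩ := hC1.bounded
  obtain ⟨MF, hMF⟩ := hC1.exists_flux_bound b c hp
  obtain ⟨K, L, hK0, hL, hK⟩ := hC1.exists_speed_bounds c p
  have hM0 : 0 ≤ M := (abs_nonneg _).trans (hM 0 0).1
  obtain ⟨B, hB⟩ : ∃ B, B = (|b / (p + 1)| + |(3 * p * c - b) / 2|) * M ^ p := ⟨_, rfl⟩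
  have hB0 : 0 ≤ B := by rw [hB]; positivity
  obtain ⟨N, hN⟩ : ∃ N, N = c1Norm v w := ⟨_, rfl⟩
  have cN : Continuous N := hN ▸ hC1.continuous_c1Norm
  have hN0 : ∀ t, 0 ≤ N t := hN ▸ hC1.c1Norm_nonneg
  have hFN : ∀ t x, |flux b c p (v t x) (w t x)| ≤ B * N t := fun t x => by
    rw [hB, hN]
    exact (abs_flux_le hp (hM t x).1 (hM t x).2).trans
      (mul_le_mul_of_nonneg_left (hC1.le_c1Norm t x) (by positivity))
  have cspeed := hC1.continuous_speed c p
  have transport : ∀ q, IsIntegralCurve T₁ (fun t x => c * v t x ^ p) q →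
      ∀ t ∈ Icc 0 T₁, v t (q t) =
        -∫ τ in t₀..t, resolventDeriv (fun y => flux b c p (v τ y) (w τ y)) (q τ) := by
    intro q hq t ht
    rw [← h.sub_eq_neg_integral hp hq ht₀ ht, h0, sub_zero]
  obtain ⟨D, hD⟩ : ∃ D, D = max B (2 * B * Real.exp (K * T₁)) := ⟨_, rfl⟩
  have hNle : ∀ t ∈ Icc 0 T₁, N t ≤ D * |∫ τ in t₀..t, N τ| := by
    intro t ht
    obtain ⟨I, hI⟩ : ∃ I, I = |∫ τ in t₀..t, N τ| := ⟨_, rfl⟩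
    have hI0 : 0 ≤ I := hI ▸ abs_nonneg _
    rw [← hI, hD, hN]
    refine c1Norm_le fun x => max_le ?_ ?_
    · obtain ⟨q, hqx, hq⟩ := exists_integralCurve cspeed hL hK ht x
      have e := transport q hq t ht
      rw [hqx] at e
      rw [e, abs_neg, ← Real.norm_eq_abs]
      refine (intervalIntegral.norm_integral_le_abs_of_norm_le (g := fun τ => B * N τ)
        (Eventually.of_forall fun τ => by
          rw [Real.norm_eq_abs]
          exact abs_resolventDeriv_le (hFN τ) (q τ))
        ((cN.const_mul B).intervalIntegrable _ _)).trans ?_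
      rw [intervalIntegral.integral_const_mul, abs_mul, abs_of_nonneg hB0, ← hI]
      exact mul_le_mul_of_nonneg_right (le_max_left _ _) hI0
    -- The derivative `w` need not be differentiable, so it is bounded through a Lipschitz estimate
    -- for `v t`, comparing the characteristics that end at `x` and `y`. The factor `2 * B` comes
    -- from `∂ₓ resolventDeriv F = resolvent F - F`, the exponential from the spreading of
    -- characteristics.
    · have hlip : ∀ y, |v t y - v t x| ≤ 2 * B * Real.exp (K * T₁) * I * |y - x| := fun y => by
        obtain ⟨q, hqx, hq⟩ := exists_integralCurve cspeed hL hK ht x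
        obtain ⟨r, hry, hr⟩ := exists_integralCurve cspeed hL hK ht y
        have e := transport q hq t ht
        have e' := transport r hr t ht
        rw [hqx] at e
        rw [hry] at e'
        rw [e, e', neg_sub_neg, ← intervalIntegral.integral_sub
          (h.intervalIntegrable_resolventDeriv hp hq ht₀ ht)
          (h.intervalIntegrable_resolventDeriv hp hr ht₀ ht), ← Real.norm_eq_abs]
        refine (intervalIntegral.norm_integral_le_abs_of_norm_le
          (g := fun τ => 2 * B * Real.exp (K * T₁) * |y - x| * N τ) ?_
          ((cN.const_mul _).intervalIntegrable _ _)).trans ?_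
        · refine (ae_restrict_iff' measurableSet_uIoc).mpr (Eventually.of_forall fun τ hτ => ?_)
          have hτ' : τ ∈ Icc 0 T₁ := uIcc_subset_Icc ht₀ ht (uIoc_subset_uIcc hτ)
          have cFτ := hC1.continuous_flux_left b c p τ
          have l1 := abs_sub_le_of_abs_deriv_le (L := 2 * (B * N τ))
            (hasDerivAt_resolventDeriv cFτ (hMF τ)) (fun z => by
              have h1 := abs_resolvent_le (hFN τ) z
              have h2 := hFN τ z
              refine (abs_sub _ _).trans ?_
              linarith) (q τ) (r τ)
          have l2 := IsIntegralCurve.abs_sub_le hq hr hK0 hK hτ' ht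
          rw [hqx, hry, abs_sub_comm x y] at l2
          refine l1.trans ?_
          have l3 : 0 ≤ 2 * (B * N τ) := by have := hN0 τ; positivity
          calc _ ≤ 2 * (B * N τ) * (Real.exp (K * T₁) * |y - x|) :=
                mul_le_mul_of_nonneg_left l2 l3
            _ = _ := by ring
        · rw [intervalIntegral.integral_const_mul, abs_mul, abs_of_nonneg (by positivity), ← hI]
          exact le_of_eq (by ring)
      have hder := (hC1.hasDerivAt t x).hasFDerivAt.le_of_lip' (C := 2 * B * Real.exp (K * T₁) * I)
        (by positivity) (Eventually.of_forall hlip)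
      have hw : |w t x| ≤ 2 * B * Real.exp (K * T₁) * I := by simpa using hder
      exact hw.trans (mul_le_mul_of_nonneg_right (le_max_right _ _) hI0)
  have hz := eq_zero_of_le_abs_integral cN hN0 ht₀ hNle ht
  have := (le_max_left _ _).trans (hC1.le_c1Norm t x)
  rw [← hN, hz] at this
  exact abs_eq_zero.mp (le_antisymm this (abs_nonneg _))

end IsEvolution

/-! ### Propagation of the sign of the momentum -/

/-- By Fubini the integral is a space primitive of the continuous function `∫ f'`, up to a constant.
-/
lemma hasDerivAt_integral_param {f f' : ℝ → ℝ → ℝ} (hf : Continuous (Function.uncurry f))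
    (hf' : Continuous (Function.uncurry f')) (hd : ∀ τ x, HasDerivAt (f τ) (f' τ x) x)
    (a b x : ℝ) :
    HasDerivAt (fun x => ∫ τ in a..b, f τ x) (∫ τ in a..b, f' τ x) x := by
  have hcx : ∀ x, Continuous fun τ => f τ x := fun x =>
    hf.comp (f := fun τ => (τ, x)) (by fun_prop)
  have hc' : ∀ τ, Continuous (f' τ) := fun τ =>
    hf'.comp (f := fun x => (τ, x)) (by fun_prop)
  have e : ∀ x, ∫ τ in a..b, f τ x =
      (∫ τ in a..b, f τ 0) + ∫ ξ in (0 : ℝ)..x, ∫ τ in a..b, f' τ ξ := fun x => by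
    rw [← integral_swap_of_continuous hf', ← sub_eq_iff_eq_add',
      ← intervalIntegral.integral_sub ((hcx x).intervalIntegrable _ _)
      ((hcx 0).intervalIntegrable _ _)]
    refine intervalIntegral.integral_congr fun τ _ => ?_
    exact (intervalIntegral.integral_eq_sub_of_hasDerivAt (fun x _ => hd τ x)
      ((hc' τ).intervalIntegrable _ _)).symm
  rw [funext e]
  have cI : Continuous fun ξ => ∫ τ in a..b, f' τ ξ :=
    intervalIntegral.continuous_parametric_intervalIntegral_of_continuous'
      (f := fun ξ τ => f' τ ξ) (hf'.comp (f := fun z : ℝ × ℝ => (z.2, z.1)) (by fun_prop)) a b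
  exact (cI.integral_hasStrictDerivAt 0 x).hasDerivAt.const_add _

/-- The momentum `v - v_xx` integrated in space. -/
def momentumPrimitive (v w : ℝ → ℝ → ℝ) (t z : ℝ) : ℝ := (∫ ξ in (0 : ℝ)..z, v t ξ) - w t z

namespace IsEvolution

variable {b c T₁ : ℝ} {p : ℕ} {v w r : ℝ → ℝ → ℝ}

/-- A space primitive of the drift. -/
def driftPrimitive (b c : ℝ) (p : ℕ) (v w : ℝ → ℝ → ℝ) (t x : ℝ) : ℝ :=
  c / (p + 1) * v t x ^ (p + 1) + resolvent (fun y => flux b c p (v t y) (w t y)) x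

lemma hasDerivAt_driftPrimitive (h : IsEvolution b c p T₁ v w) (hp : 0 < p) (t x : ℝ) :
    HasDerivAt (driftPrimitive b c p v w t) (drift b c p v w t x) x := by
  obtain ⟨M, hM⟩ := h.exists_flux_bound b c hp
  have h1 := ((h.hasDerivAt t x).pow (p + 1)).const_mul (c / ((p : ℝ) + 1))
  have h2 := hasDerivAt_resolvent (h.continuous_flux_left b c p t) (hM t) x
  convert! h1.add h2 using 1
  have : (p : ℝ) + 1 ≠ 0 := by positivity
  simp only [drift, Nat.add_sub_cancel]
  push_cast
  field_simp

lemma continuous_driftPrimitive (h : IsEvolution b c p T₁ v w) (hp : 0 < p) :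
    Continuous (Function.uncurry (driftPrimitive b c p v w)) := by
  obtain ⟨M, hM⟩ := h.exists_flux_bound b c hp
  exact (continuous_const.mul (h.cont.pow (p + 1))).add
    (continuous_uncurry_resolvent (h.continuous_flux b c p) hM)

/-- The space derivative of the drift. -/
def driftDeriv (b c : ℝ) (p : ℕ) (v w r : ℝ → ℝ → ℝ) (t x : ℝ) : ℝ :=
  c * (p * v t x ^ (p - 1) * w t x * w t x + v t x ^ p * r t x) +
    (resolvent (fun y => flux b c p (v t y) (w t y)) x - flux b c p (v t x) (w t x))

lemma hasDerivAt_drift (h : IsEvolution b c p T₁ v w) (hp : 0 < p)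
    (hr : ∀ t x, HasDerivAt (w t) (r t x) x) (t x : ℝ) :
    HasDerivAt (drift b c p v w t) (driftDeriv b c p v w r t x) x := by
  obtain ⟨M, hM⟩ := h.exists_flux_bound b c hp
  exact ((((h.hasDerivAt t x).pow p).mul (hr t x)).const_mul c).add
    (hasDerivAt_resolventDeriv (h.continuous_flux_left b c p t) (hM t) x)

lemma continuous_driftDeriv (h : IsEvolution b c p T₁ v w) (hp : 0 < p)
    (cr : Continuous (Function.uncurry r)) :
    Continuous (Function.uncurry (driftDeriv b c p v w r)) := by
  obtain ⟨M, hM⟩ := h.exists_flux_bound b c hp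
  have h1 := h.cont
  have h2 := h.cont_deriv
  have h3 := continuous_uncurry_resolvent (h.continuous_flux b c p) hM
  have h4 := h.continuous_flux b c p
  simp only [Function.uncurry_def] at *
  unfold driftDeriv
  fun_prop

/-- The momentum equation `m_t + (c u^p m)_x = 0`, integrated in space and time. -/
lemma momentumPrimitive_sub (h : IsEvolution (p * c) c p T₁ v w) (hp : 0 < p)
    (cr : Continuous (Function.uncurry r)) (hr : ∀ t x, HasDerivAt (w t) (r t x) x)
    {t : ℝ} (ht : t ∈ Icc 0 T₁) (z : ℝ) :
    momentumPrimitive v w t z = momentumPrimitive v w 0 z +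
      ∫ τ in (0 : ℝ)..t, (driftPrimitive (p * c) c p v w τ 0 -
        c * v τ z ^ p * (v τ z - r τ z)) := by
  have h0 : (0 : ℝ) ∈ Icc 0 T₁ := ⟨le_rfl, ht.1.trans ht.2⟩
  have cd := h.continuous_drift (p * c) c hp
  have cd' := h.continuous_driftDeriv hp cr
  have cE := h.continuous_driftPrimitive hp
  have cEz : ∀ z, Continuous fun τ => driftPrimitive (p * c) c p v w τ z := fun z =>
    cE.comp (f := fun τ => (τ, z)) (by fun_prop)
  have cd'z : Continuous fun τ => driftDeriv (p * c) c p v w r τ z :=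
    cd'.comp (f := fun τ => (τ, z)) (by fun_prop)
  have e1 : w t z - w 0 z = -∫ τ in (0 : ℝ)..t, driftDeriv (p * c) c p v w r τ z := by
    have d1 := (h.hasDerivAt t z).sub (h.hasDerivAt 0 z)
    have d2 := (hasDerivAt_integral_param cd cd' (h.hasDerivAt_drift hp hr) 0 t z).neg
    refine d1.unique ?_
    convert! d2 using 1
    funext x
    exact h.evolves 0 h0 t ht x
  have e2 : (∫ ξ in (0 : ℝ)..z, v t ξ) - (∫ ξ in (0 : ℝ)..z, v 0 ξ) =
      -∫ τ in (0 : ℝ)..t, (driftPrimitive (p * c) c p v w τ z -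
        driftPrimitive (p * c) c p v w τ 0) := by
    rw [← intervalIntegral.integral_sub ((h.continuous_left t).intervalIntegrable _ _)
      ((h.continuous_left 0).intervalIntegrable _ _)]
    have : ∀ τ, driftPrimitive (p * c) c p v w τ z - driftPrimitive (p * c) c p v w τ 0 =
        ∫ ξ in (0 : ℝ)..z, drift (p * c) c p v w τ ξ := fun τ =>
      (intervalIntegral.integral_eq_sub_of_hasDerivAt
        (fun x _ => h.hasDerivAt_driftPrimitive hp τ x)
        ((cd.comp (f := fun x => (τ, x)) (by fun_prop)).intervalIntegrable _ _)).symm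
    simp only [this]
    rw [integral_swap_of_continuous cd, ← intervalIntegral.integral_neg]
    exact intervalIntegral.integral_congr fun ξ _ => h.evolves 0 h0 t ht ξ
  -- The resolvent at `z` cancels. With `b = pc` the `w²` terms cancel too, and the coefficients of
  -- `v^{p+1}` add up to `c`.
  have e3 : ∫ τ in (0 : ℝ)..t, (driftPrimitive (p * c) c p v w τ 0 -
        c * v τ z ^ p * (v τ z - r τ z)) =
      -(∫ τ in (0 : ℝ)..t, (driftPrimitive (p * c) c p v w τ z -
        driftPrimitive (p * c) c p v w τ 0)) +
        ∫ τ in (0 : ℝ)..t, driftDeriv (p * c) c p v w r τ z := by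
    rw [← intervalIntegral.integral_neg, ← intervalIntegral.integral_add
      (Continuous.intervalIntegrable (by have := cEz z; have := cEz 0; fun_prop) _ _)
      (cd'z.intervalIntegrable _ _)]
    refine intervalIntegral.integral_congr fun τ _ => ?_
    have p1 : (p : ℝ) + 1 ≠ 0 := by positivity
    simp only [driftPrimitive, driftDeriv]
    generalize resolvent _ z = g
    generalize resolvent _ 0 = g₀
    simp only [flux]
    field_simp
    ring
  rw [e3]
  unfold momentumPrimitive
  linarith

lemma continuous_momentumPrimitive (h : IsEvolution b c p T₁ v w) :
    Continuous (Function.uncurry (momentumPrimitive v w)) :=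
  (intervalIntegral.continuous_parametric_primitive_of_continuous h.cont).sub h.cont_deriv

lemma hasDerivAt_momentumPrimitive (h : IsEvolution b c p T₁ v w)
    (hr : ∀ t x, HasDerivAt (w t) (r t x) x) (t x : ℝ) :
    HasDerivAt (momentumPrimitive v w t) (v t x - r t x) x :=
  ((h.continuous_left t).integral_hasStrictDerivAt 0 x).hasDerivAt.sub (hr t x)

/-- The mass of the momentum between two characteristics is conserved. -/
lemma momentumPrimitive_transport (h : IsEvolution (p * c) c p T₁ v w) (hp : 0 < p)
    (cr : Continuous (Function.uncurry r)) (hr : ∀ t x, HasDerivAt (w t) (r t x) x)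
    {q : ℝ → ℝ} (hq : IsIntegralCurve T₁ (fun t x => c * v t x ^ p) q)
    {t : ℝ} (ht : t ∈ Icc 0 T₁) :
    momentumPrimitive v w t (q t) = momentumPrimitive v w 0 (q 0) +
      ∫ τ in (0 : ℝ)..t, driftPrimitive (p * c) c p v w τ 0 := by
  have h0 : (0 : ℝ) ∈ Icc 0 T₁ := ⟨le_rfl, ht.1.trans ht.2⟩
  have cE : Continuous fun τ => driftPrimitive (p * c) c p v w τ 0 :=
    (h.continuous_driftPrimitive hp).comp (f := fun τ => (τ, 0)) (by fun_prop)
  have cR : Continuous (Function.uncurry fun τ z => driftPrimitive (p * c) c p v w τ 0 -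
        c * v τ z ^ p * (v τ z - r τ z)) := by
    have h1 := h.cont
    simp only [Function.uncurry_def] at *
    fun_prop
  have := hq.sub_eq_integral (h.continuous_speed c p) h.continuous_momentumPrimitive
    (W := fun t x => v t x - r t x) (h.cont.sub cr) cR (h.hasDerivAt_momentumPrimitive hr) (fun s hs z => by
      have cRz : Continuous fun τ => driftPrimitive (p * c) c p v w τ 0 -
          c * v τ z ^ p * (v τ z - r τ z) := cR.comp (f := fun τ => (τ, z)) (by fun_prop)
      refine ((cRz.integral_hasStrictDerivAt 0 s).hasDerivAt.const_add
        (momentumPrimitive v w 0 z)).congr_of_eventuallyEq ?_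
      filter_upwards [Ioo_mem_nhds hs.1 hs.2] with y hy
      exact h.momentumPrimitive_sub hp cr hr (Ioo_subset_Icc_self hy) z) h0 ht
  rw [← sub_eq_iff_eq_add', this]
  -- The term `c v^p (v - r)` cancels against transport; what is left does not depend on the
  -- characteristic.
  refine intervalIntegral.integral_congr fun τ _ => ?_
  ring

/-- The sign of the momentum is preserved. -/
lemma momentum_sign (h : IsEvolution (p * c) c p T₁ v w) (hp : 0 < p)
    (cr : Continuous (Function.uncurry r)) (hr : ∀ t x, HasDerivAt (w t) (r t x) x)
    {ε : ℝ} (hε : ∀ x, 0 ≤ ε * (v 0 x - r 0 x)) {t : ℝ} (ht : t ∈ Icc 0 T₁) (x : ℝ) :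
    0 ≤ ε * (v t x - r t x) := by
  have h0 : (0 : ℝ) ∈ Icc 0 T₁ := ⟨le_rfl, ht.1.trans ht.2⟩
  have hd : ∀ s z, HasDerivAt (fun z => ε * momentumPrimitive v w s z)
      (ε * (v s z - r s z)) z := fun s z => (h.hasDerivAt_momentumPrimitive hr s z).const_mul ε
  have m0 : Monotone fun z => ε * momentumPrimitive v w 0 z :=
    monotone_of_deriv_nonneg (fun z => (hd 0 z).differentiableAt)
      (fun z => by rw [(hd 0 z).deriv]; exact hε z)
  obtain ⟨K, L, hK0, hL, hK⟩ := h.exists_speed_bounds c p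
  have cspeed := h.continuous_speed c p
  -- The sign of the momentum is monotonicity of its primitive. Characteristics keep their order,
  -- and the increment between two of them equals the initial one, so no derivative of the momentum
  -- is needed.
  have mt : Monotone fun z => ε * momentumPrimitive v w t z := by
    intro z z' hz
    rcases hz.eq_or_lt with rfl | hlt
    · exact le_rfl
    obtain ⟨q, hqz, hq⟩ := exists_integralCurve cspeed hL hK ht z
    obtain ⟨q', hqz', hq'⟩ := exists_integralCurve cspeed hL hK ht z'
    have hle : q 0 ≤ q' 0 := IsIntegralCurve.le_of_lt hq hq' hK0 hK h0 ht (by rwa [hqz, hqz'])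
    have e := h.momentumPrimitive_transport hp cr hr hq ht
    have e' := h.momentumPrimitive_transport hp cr hr hq' ht
    rw [hqz] at e
    rw [hqz'] at e'
    have := m0 hle
    simp only [e, e', mul_add] at this ⊢
    linarith
  rw [← (hd t x).deriv]
  exact mt.deriv_nonneg

end IsEvolution

/-- Minimum principle for `1 - ∂ₓ²` on the circle. -/
lemma nonneg_of_sub_deriv_two_nonneg {f f' f'' : ℝ → ℝ} (hp : Function.Periodic f 1)
    (hf : ∀ x, HasDerivAt f (f' x) x) (hf' : ∀ x, HasDerivAt f' (f'' x) x)
    (h : ∀ x, 0 ≤ f x - f'' x) (x : ℝ) : 0 ≤ f x := by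
  have hc : Continuous f := continuous_iff_continuousAt.mpr fun x => (hf x).continuousAt
  obtain ⟨y, -, hy⟩ := isCompact_Icc.exists_isMinOn (nonempty_Icc.mpr (zero_le_one' ℝ))
    hc.continuousOn
  have hmin : ∀ z, f y ≤ f z := fun z => by
    obtain ⟨z', hz', hzz⟩ := hp.exists_mem_Ico₀ one_pos z
    rw [hzz]
    exact hy (Ico_subset_Icc_self hz')
  by_contra! hneg
  have hy0 : f y < 0 := (hmin x).trans_lt hneg
  have hlm : IsLocalMin f y := Eventually.of_forall hmin
  have ed : deriv f = f' := funext fun x => (hf x).deriv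
  have edd : deriv (deriv f) y = f'' y := by rw [ed, (hf' y).deriv]
  -- At a negative minimum `f'' ≤ f < 0`, so the point is also a local maximum; then `f` is locally
  -- constant and `f'' = 0`, a contradiction.
  have hlM : IsLocalMax f y := isLocalMax_of_deriv_deriv_neg
    (by rw [edd]; linarith [h y]) hlm.deriv_eq_zero hc.continuousAt
  have hconst : f =ᶠ[𝓝 y] fun _ => f y := by
    filter_upwards [hlM] with z hz
    exact le_antisymm hz (hmin z)
  have h1 : deriv f =ᶠ[𝓝 y] fun _ => 0 := by
    have := hconst.deriv
    simpa using this
  have h2 : deriv (deriv f) y = 0 := by rw [h1.deriv_eq, deriv_const]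
  rw [edd] at h2
  linarith [h y]

/-! ### Vanishing at one time -/

lemma resolventDeriv_const_mul (ε : ℝ) (f : ℝ → ℝ) (x : ℝ) :
    resolventDeriv (fun y => ε * f y) x = ε * resolventDeriv f x := by
  have h : ∀ (f : ℝ → ℝ) x, expRight (fun y => ε * f y) x = ε * expRight f x := fun f x => by
    unfold expRight
    rw [← integral_const_mul]
    refine integral_congr_ae (Eventually.of_forall fun r => ?_)
    ring
  simp only [resolventDeriv, expLeft, h]
  ring

/-- For `b = pc` the coefficients of the flux are `pc/(p+1)` and `(3pc - pc)/2 = pc`, so only the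
signs of the powers of `y` matter. The factor `ε` treats both signs of the solution together. -/
lemma mul_flux_nonneg {c ε y : ℝ} {p : ℕ} (hc : 0 < c)
    (h₁ : 0 ≤ ε * y ^ (p + 1)) (h₂ : 0 ≤ ε * y ^ (p - 1)) (z : ℝ) :
    0 ≤ ε * flux (p * c) c p y z := by
  have e : ε * flux (p * c) c p y z = p * c / (p + 1) * (ε * y ^ (p + 1)) +
      p * c * (ε * y ^ (p - 1)) * z ^ 2 := by
    unfold flux
    ring
  rw [e]
  positivity

lemma eq_zero_of_flux_eq_zero {c ε y z : ℝ} {p : ℕ} (hp : 0 < p) (hc : 0 < c) (hε : ε ≠ 0)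
    (h₁ : 0 ≤ ε * y ^ (p + 1)) (h₂ : 0 ≤ ε * y ^ (p - 1))
    (h : flux (p * c) c p y z = 0) : y = 0 := by
  have e : ε * flux (p * c) c p y z = p * c / (p + 1) * (ε * y ^ (p + 1)) +
      p * c * (ε * y ^ (p - 1)) * z ^ 2 := by
    unfold flux
    ring
  rw [h, mul_zero] at e
  have h3 : 0 ≤ p * c * (ε * y ^ (p - 1)) * z ^ 2 := by positivity
  have h4 : 0 < (p : ℝ) * c / (p + 1) := by positivity
  have h5 : ε * y ^ (p + 1) = 0 := by nlinarith
  exact eq_zero_of_pow_eq_zero ((mul_eq_zero.mp h5).resolve_left hε)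

namespace IsEvolution

variable {b c T₁ : ℝ} {p : ℕ} {v w : ℝ → ℝ → ℝ}

/-- If a solution vanishes on an interval, with vanishing time derivative at its ends, and the flux
has a sign, then the flux is zero. -/
lemma flux_eq_zero (h : IsEvolution b c p T₁ v w) (hp : 0 < p) {t : ℝ} (ht : t ∈ Ioo 0 T₁)
    {x₀ x₁ : ℝ} (hx : x₀ < x₁) (hz : ∀ x ∈ Icc x₀ x₁, v t x = 0)
    (hd₀ : HasDerivAt (fun t => v t x₀) 0 t) (hd₁ : HasDerivAt (fun t => v t x₁) 0 t)
    {ε : ℝ} (hε : ε ≠ 0) (hsign : ∀ x, 0 ≤ ε * flux b c p (v t x) (w t x)) (x : ℝ) :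
    flux b c p (v t x) (w t x) = 0 := by
  obtain ⟨M, hM⟩ := h.exists_flux_bound b c hp
  -- Where `v` vanishes there is no transport term, and the time derivative is just minus the
  -- nonlocal term.
  have hdrift : ∀ y ∈ Icc x₀ x₁, HasDerivAt (fun t => v t y) 0 t →
      resolventDeriv (fun y => ε * flux b c p (v t y) (w t y)) y = 0 := fun y hy hd => by
    have h1 := hd.unique (h.hasDerivAt_time hp ht y)
    rw [drift, hz y hy, zero_pow hp.ne', zero_mul, mul_zero, zero_add] at h1
    rw [resolventDeriv_const_mul, neg_eq_zero.mp h1.symm, mul_zero]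
  -- Derivatives within the closed interval are unique even at its ends, so one-sided information
  -- suffices there.
  have hw : ∀ y ∈ Icc x₀ x₁, w t y = 0 := fun y hy => by
    have h1 : HasDerivWithinAt (v t) (w t y) (Icc x₀ x₁) y := (h.hasDerivAt t y).hasDerivWithinAt
    have h2 : HasDerivWithinAt (v t) 0 (Icc x₀ x₁) y :=
      (hasDerivWithinAt_const y (Icc x₀ x₁) (0 : ℝ)).congr hz (hz y hy)
    exact (uniqueDiffOn_Icc hx y hy).eq_deriv _ h1 h2
  have cF := h.continuous_flux_left b c p t
  have key := eq_zero_of_resolventDeriv_eq_zero (M := |ε| * M)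
    (f := fun y => ε * flux b c p (v t y) (w t y)) (by fun_prop)
    (fun y => by
      rw [abs_mul]
      exact mul_le_mul_of_nonneg_left (hM t y) (abs_nonneg _))
    (fun y => by
      have := h.periodic_flux b c p t y
      simp only at this ⊢
      rw [this]) hsign hx
    (fun y hy => by
      simp only [flux, hz y hy, hw y hy]
      simp)
    (hdrift x₀ (left_mem_Icc.mpr hx.le) hd₀) (hdrift x₁ (right_mem_Icc.mpr hx.le) hd₁) x
  exact (mul_eq_zero.mp key).resolve_left hε

/-- The case `p = 1`, `0 ≤ b ≤ 3 * c`. -/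
lemma eq_zero_at_of_p_eq_one (h : IsEvolution b c 1 T₁ v w) (hb : 0 ≤ b) (hbc : b ≤ 3 * c)
    (hc : 0 < c) {t : ℝ} (ht : t ∈ Ioo 0 T₁)
    {x₀ x₁ : ℝ} (hx : x₀ < x₁) (hz : ∀ x ∈ Icc x₀ x₁, v t x = 0)
    (hd₀ : HasDerivAt (fun t => v t x₀) 0 t) (hd₁ : HasDerivAt (fun t => v t x₁) 0 t) (x : ℝ) :
    v t x = 0 := by
  have e : ∀ x, flux b c 1 (v t x) (w t x) =
      b / 2 * v t x ^ 2 + (3 * c - b) / 2 * w t x ^ 2 := fun x => by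
    simp only [flux, Nat.cast_one, Nat.sub_self, pow_zero]
    norm_num
  have h3 : 0 ≤ 3 * c - b := by linarith
  have hF := h.flux_eq_zero one_pos ht hx hz hd₀ hd₁ one_ne_zero
    (fun x => by rw [e]; positivity)
  -- For `b = 0` the flux only sees `w`; then `v t` is constant, and its value is read off at `x₀`.
  rcases hb.eq_or_lt with rfl | hb'
  · have hw : ∀ x, w t x = 0 := fun x => by
      have h1 := hF x
      rw [e] at h1
      have h2 : w t x ^ 2 = 0 := by nlinarith [sq_nonneg (w t x)]
      exact pow_eq_zero_iff two_ne_zero |>.mp h2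
    have hconst := is_const_of_deriv_eq_zero (f := v t)
      (fun x => (h.hasDerivAt t x).differentiableAt)
      (fun x => by rw [(h.hasDerivAt t x).deriv, hw]) x x₀
    rw [hconst, hz x₀ (left_mem_Icc.mpr hx.le)]
  · have h1 := hF x
    rw [e] at h1
    have h2 : 0 ≤ (3 * c - b) / 2 * w t x ^ 2 := by positivity
    have h4 : v t x ^ 2 = 0 := by nlinarith [sq_nonneg (v t x)]
    exact pow_eq_zero_iff two_ne_zero |>.mp h4

/-- The case `b = pc`, for solutions whose powers have a sign. -/
lemma eq_zero_at_of_sign (h : IsEvolution (p * c) c p T₁ v w) (hp : 0 < p)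
    (hc : 0 < c) {t : ℝ} (ht : t ∈ Ioo 0 T₁)
    {x₀ x₁ : ℝ} (hx : x₀ < x₁) (hz : ∀ x ∈ Icc x₀ x₁, v t x = 0)
    (hd₀ : HasDerivAt (fun t => v t x₀) 0 t) (hd₁ : HasDerivAt (fun t => v t x₁) 0 t)
    {ε : ℝ} (hε : ε ≠ 0) (h₁ : ∀ x, 0 ≤ ε * v t x ^ (p + 1)) (h₂ : ∀ x, 0 ≤ ε * v t x ^ (p - 1))
    (x : ℝ) : v t x = 0 :=
  eq_zero_of_flux_eq_zero hp hc hε (h₁ x) (h₂ x)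
    (h.flux_eq_zero hp ht hx hz hd₀ hd₁ hε
      (fun y => mul_flux_nonneg hc (h₁ y) (h₂ y) (w t y)) x)

end IsEvolution

/-- In `H³`, with `b = pc`, the sign of the initial momentum is inherited by the solution. -/
lemma sign_of_momentum_sign {c T T₁ : ℝ} {p : ℕ} (hp : 0 < p) {u : ℝ → ℝ → ℝ}
    (hu : ContinuousInSobolev 3 T u)
    (h : IsEvolution (p * c) c p T₁ (fun t => u (clampTime T₁ t))
      (fun t => deriv (u (clampTime T₁ t)))) (hT₁ : 0 ≤ T₁) (hT : T₁ < T)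
    {ε : ℝ} (hε : ∀ x, 0 ≤ ε * momentum (u 0) x) {t : ℝ} (ht : t ∈ Icc 0 T₁) (x : ℝ) :
    0 ≤ ε * u t x := by
  have s2 : ((2 : ℕ) : ℝ) + 1 / 2 < 3 := by norm_num
  have hmem : ∀ t, clampTime T₁ t ∈ Ico 0 T := fun t =>
    ⟨(clampTime_mem hT₁ t).1, (clampTime_mem hT₁ t).2.trans_lt hT⟩
  have cr := continuous_iteratedDeriv_clamp hu hT₁ hT s2
  have hr : ∀ t x, HasDerivAt (deriv (u (clampTime T₁ t)))
      (iteratedDeriv 2 (u (clampTime T₁ t)) x) x := fun t x => by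
    have := hasDerivAt_iteratedDeriv_of_memSobolev (hu.mem _ (hmem t))
      (hu.continuous_rep _ (hmem t)) (n := 1) s2 x
    simpa only [iteratedDeriv_one] using this
  have hsign := h.momentum_sign hp cr hr (ε := ε)
    (fun x => by
      simp only [clampTime_of_mem (left_mem_Icc.mpr hT₁)]
      exact hε x) ht
  have := nonneg_of_sub_deriv_two_nonneg
    (f := fun x => ε * u (clampTime T₁ t) x)
    (f' := fun x => ε * deriv (u (clampTime T₁ t)) x)
    (f'' := fun x => ε * iteratedDeriv 2 (u (clampTime T₁ t)) x)
    (fun x => by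
      have := h.periodic t x
      simp only at this ⊢
      rw [this])
    (fun x => (h.hasDerivAt t x).const_mul ε) (fun x => (hr t x).const_mul ε)
    (fun x => by rw [← mul_sub]; exact hsign x) x
  simpa only [clampTime_of_mem ht] using this

end PeriodicFamily

end

/-! ### The theorem -/

open PeriodicFamily in
theorem theorem2p3 (b c : ℝ) (p : ℕ) (hb : 0 ≤ b) (hc : 0 < c) (hp : 0 < p)
    (s T : ℝ) (hs : 3 / 2 < s) (u : ℝ → ℝ → ℝ)
    (hu : ContinuousInSobolev s T u) (hsol : SolvesWeakly b c p T u)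
    (hcases : (p = 1 ∧ b ∈ Set.Icc 0 (3 * c)) ∨
      (b = p * c ∧ Odd p) ∨
      (b = p * c ∧ Even p ∧ s = 3 ∧
        ((∀ x, 0 ≤ momentum (u 0) x) ∨ (∀ x, momentum (u 0) x ≤ 0))))
    (t' : ℝ) (ht' : t' ∈ Set.Ioo 0 T)
    (x₀ x₁ : ℝ) (hx₀ : x₀ ∈ Set.Ico (0 : ℝ) 1) (hx₁ : x₁ ∈ Set.Ico (0 : ℝ) 1) (hx : x₀ < x₁)
    (hzero : ∀ x ∈ Set.Icc x₀ x₁, u t' x = 0)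
    (hd₀ : HasDerivAt (fun t => u t x₀) 0 t')
    (hd₁ : HasDerivAt (fun t => u t x₁) 0 t') :
    ∀ t ∈ Set.Ico 0 T, ∀ x, u t x = 0 := by
  intro t ht x
  have hmax : max t t' < T := max_lt ht.2 ht'.2
  -- A compact time interval that contains `t` and has `t'` in its interior.
  obtain ⟨T₁, hT₁, hT⟩ := exists_between hmax
  have htT : t ∈ Icc 0 T₁ := ⟨ht.1, ((le_max_left _ _).trans_lt hT₁).le⟩
  have ht'T : t' ∈ Ioo 0 T₁ := ⟨ht'.1, (le_max_right _ _).trans_lt hT₁⟩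
  have hT₁0 : 0 < T₁ := ht'T.1.trans ht'T.2
  -- This is the coefficient of the cubic term, which the nonlocal form omits.
  have hbc : ((p : ℝ) - 1) * (b - p * c) = 0 := by
    rcases hcases with ⟨rfl, -⟩ | ⟨rfl, -⟩ | ⟨rfl, -⟩ <;> simp
  have h := isEvolution_clamp hp hs hu hsol hbc hT₁0 hT
  have hct : clampTime T₁ t' = t' := clampTime_of_mem (Ioo_subset_Icc_self ht'T)
  have hloc : ∀ y, HasDerivAt (fun t => u t y) 0 t' →
      HasDerivAt (fun t => u (clampTime T₁ t) y) 0 t' := fun y hy => by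
    refine hy.congr_of_eventuallyEq ?_
    filter_upwards [Ioo_mem_nhds ht'T.1 ht'T.2] with r hr
    rw [clampTime_of_mem (Ioo_subset_Icc_self hr)]
  have hz : ∀ x ∈ Icc x₀ x₁, u (clampTime T₁ t') x = 0 := by rwa [hct]
  have hvanish : ∀ x, u (clampTime T₁ t') x = 0 := by
    rcases hcases with ⟨rfl, hb'⟩ | ⟨rfl, hodd⟩ | ⟨rfl, heven, rfl, hm⟩
    · exact h.eq_zero_at_of_p_eq_one hb hb'.2 hc ht'T hx hz (hloc _ hd₀) (hloc _ hd₁)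
    · refine h.eq_zero_at_of_sign hp hc ht'T hx hz (hloc _ hd₀) (hloc _ hd₁) one_ne_zero
        (fun x => ?_) (fun x => ?_)
      · rw [one_mul]
        exact hodd.add_one.pow_nonneg _
      · rw [one_mul]
        exact (Nat.Odd.sub_odd hodd odd_one).pow_nonneg _
    · obtain ⟨ε, hε, hεm⟩ : ∃ ε : ℝ, ε ≠ 0 ∧ ∀ x, 0 ≤ ε * momentum (u 0) x := by
        rcases hm with hm | hm
        · exact ⟨1, one_ne_zero, fun x => by simpa using hm x⟩
        · exact ⟨-1, by norm_num, fun x => by simpa using hm x⟩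
      have hsign : ∀ x, 0 ≤ ε * u (clampTime T₁ t') x := fun x => by
        rw [hct]
        exact sign_of_momentum_sign hp hu h hT₁0.le hT hεm (Ioo_subset_Icc_self ht'T) x
      refine h.eq_zero_at_of_sign hp hc ht'T hx hz (hloc _ hd₀) (hloc _ hd₁) hε
        (fun x => ?_) (fun x => ?_)
      · rw [pow_succ', ← mul_assoc]
        exact mul_nonneg (hsign x) (heven.pow_nonneg _)
      -- Since `p` is even and positive, `p - 1` is odd: one factor of the power takes its sign from
      -- `ε`, the others form an even power.
      · obtain ⟨k, hk⟩ : ∃ k, p - 1 = 2 * k + 1 := by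
          obtain ⟨k, hk⟩ := heven
          exact ⟨k - 1, by omega⟩
        rw [hk, pow_succ', ← mul_assoc]
        exact mul_nonneg (hsign x) ((even_two_mul k).pow_nonneg _)
  have := h.eq_zero_of_eq_zero hp (Ioo_subset_Icc_self ht'T) hvanish htT x
  simpa only [clampTime_of_mem htT] using this
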